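/- For a graph $G$ let $f(G)$ be the number of induced cycles of $G$ (cycles of any length at least $3$ that are induced subgraphs of $G$), and let $m(n)$ be the maximum of $f(G)$ over all graphs $G$ on $n$ vertices. A graph $B$ is a cyclic braid if for some $k\ge 3$ there is a partition $B_1,\dots,B_k$ of $V(B)$ into non-empty sets (the clusters) such that, for every $1\le i\le k$ and every $x\in B_i$, $$B_{i-1}\cup B_{i+1}\subseteq N_B(x)\subseteq B_{i-1}\cup B_i\cup B_{i+1},$$ with indices modulo $k$; edges inside the clusters are arbitrary. Theorem. Fix $0<\alpha<1$. There exist constants $C=C(\alpha)$ and $n_0=n_0(\alpha)$ such that the following holds for every $n\ge n_0$. If $F$ is a graph on $n$ vertices with $f(F)\ge\alpha\, m(n)$, then there are a set $S\subseteq V(F)$ with $|S|\le C$ and a graph $F'$ on $V(F)$, obtained from $F$ by adding or deleting only edges with at least one end in $S$, such that $F'$ is a cyclic braid whose clusters all have size $3$, except for exactly one cluster of size $4$ if $n\equiv 1 \pmod 3$ and exactly one cluster of size $2$ if $n\equiv 2\pmod 3$ (these are the cluster sizes of the graph $H_n$, the empty cyclic braid on $n$ vertices with this description). -/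

import Mathlib

/-- `S` is the vertex set of an induced cycle of `G`: the subgraph of `G` induced on `S` is a
cycle with `k ≥ 3` vertices (triangles count). An induced cycle is determined by its vertex set. -/
def IsInducedCycle {V : Type*} (G : SimpleGraph V) (S : Finset V) : Prop :=
  ∃ k : ℕ, 3 ≤ k ∧ Nonempty (SimpleGraph.cycleGraph k ≃g G.induce (S : Set V))

/-- The number of induced cycles (of all lengths) of `G`. -/
noncomputable def numInducedCycles {V : Type*} (G : SimpleGraph V) : ℕ :=
  {S : Finset V | IsInducedCycle G S}.ncard

/-- `m(n)`: the maximum number of induced cycles in a graph on `n` vertices. The supremum is over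
a finite nonempty set, so it is attained. -/
noncomputable def maxInducedCycles (n : ℕ) : ℕ :=
  sSup (Set.range fun G : SimpleGraph (Fin n) => numInducedCycles G)

/-- `G` is a cyclic braid of length `k` with clusters `B 0, …, B (k - 1)`. The cyclic successor
`i + 1` modulo `k` of an index `i` is `finRotate k i`, and `i - 1` is `(finRotate k).symm i`.
Edges inside a cluster are unrestricted. -/
structure IsCyclicBraid {V : Type*} (G : SimpleGraph V) {k : ℕ} (B : Fin k → Finset V) :
    Prop where
  three_le : 3 ≤ k
  nonempty : ∀ i, (B i).Nonempty
  partition : ∀ v, ∃! i, v ∈ B i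
  subset_neighborSet : ∀ i, ∀ x ∈ B i,
    (B ((finRotate k).symm i) ∪ B (finRotate k i) : Set V) ⊆ G.neighborSet x
  neighborSet_subset : ∀ i, ∀ x ∈ B i,
    G.neighborSet x ⊆ (B ((finRotate k).symm i) ∪ B i ∪ B (finRotate k i) : Set V)

/-- The multiset of cluster sizes of a family of clusters. -/
def clusterSizes {V : Type*} {k : ℕ} (B : Fin k → Finset V) : Multiset ℕ :=
  Finset.univ.val.map fun i => (B i).card

/-- The cluster sizes of the extremal graph `H_n` (`n ≥ 8`), an empty cyclic braid on `n` vertices: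
all clusters have size `3`, except for one of size `4` if `n ≡ 1 (mod 3)` and one of size `2`
if `n ≡ 2 (mod 3)`. -/
def extremalClusterSizes (n : ℕ) : Multiset ℕ :=
  if n % 3 = 0 then Multiset.replicate (n / 3) 3
  else if n % 3 = 1 then 4 ::ₘ Multiset.replicate (n / 3 - 1) 3
  else 2 ::ₘ Multiset.replicate (n / 3) 3

/-!
Deleting a vertex turns an induced cycle into an induced path, so it is enough to understand graphs
with at least `ρ * 3 ^ (|W| / 3)` induced paths from `x` to `w` through `W`, for some constant `ρ`.
Exploring a path, a vertex with `d` new neighbours multiplies the number of continuations by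
`d ≤ 3 ^ (d / 3)`, with equality only for `d = 3`. The loss for `d ≠ 3` is a definite factor, so the
number of paths is at most `3 ^ (|W| / 3)`, and an average path has bounded defect: all but boundedly
many steps see exactly three new vertices. Comparing a path with its reverse, only boundedly many
vertices have neighbours both before and after a given point of an average path.

Suppose that no deletion of boundedly many vertices increases the density, the quotient of the
number of paths by `3 ^ (|W| / 3)`, by more than a factor `1 + δ`. Then the tree of paths is ternary
to a large depth `M`, and its branches carry about equally many paths. If the three neighbours of
`x` had different further neighbours, then inhomogeneous steps would occur all along the paths and
each would produce a chord on a proportion of the paths, a vertex with two neighbours at some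
distance on the path. Few chords are long, by the bound on the reverse exploration, and the shorter
chords are no more frequent up to a constant factor, because taking a short chord as a shortcut
gives a path with a longer chord. This is a contradiction for large `M`. Hence the neighbours of `x`
form a cluster of a braid, which can be split off. As the density is at most `1`, it can be
increased by a factor `1 + δ` only boundedly often, so deleting boundedly many vertices in total
leaves a chain of clusters, which is then closed up to a cyclic braid.
-/

/-! ### Induced paths -/

section

variable {V : Type*} {G : SimpleGraph V}

/-- The list `l` is, in this order, the vertex sequence of an induced path of `G`. -/
def IsInducedPath (G : SimpleGraph V) : List V → Prop
  | [] => True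
  | a :: l => a ∉ l ∧ (∀ c ∈ l, G.Adj a c ↔ l.head? = some c) ∧ IsInducedPath G l

theorem isInducedPath_append {l₁ l₂ : List V} :
    IsInducedPath G (l₁ ++ l₂) ↔ IsInducedPath G l₁ ∧ IsInducedPath G l₂ ∧
      ∀ a ∈ l₁, ∀ b ∈ l₂, a ≠ b ∧ (G.Adj a b ↔ l₁.getLast? = some a ∧ l₂.head? = some b) := by
  induction l₁ with
  | nil => simp [IsInducedPath]
  | cons a l ih =>
    rw [List.cons_append, IsInducedPath, IsInducedPath, ih]
    rcases l with _ | ⟨b, l⟩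
    · simp only [List.nil_append, List.mem_cons, List.not_mem_nil, IsInducedPath,
        List.getLast?_singleton, Option.some.injEq]
      grind
    · have hlast : (a :: b :: l).getLast? = (b :: l).getLast? := List.getLast?_cons_cons
      have hmem : ∀ c, (b :: l).getLast? = some c → c ∈ b :: l := fun _ ↦ List.mem_of_getLast?
      rw [hlast]
      generalize (b :: l).getLast? = o at *
      simp only [List.cons_append, List.head?_cons, Option.some.injEq]
      grind

theorem IsInducedPath.nodup {l : List V} (h : IsInducedPath G l) : l.Nodup := by
  induction l with
  | nil => exact List.nodup_nil
  | cons a l ih => exact List.nodup_cons.2 ⟨h.1, ih h.2.2⟩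

theorem isInducedPath_singleton (a : V) : IsInducedPath G [a] := by
  simp [IsInducedPath]

theorem IsInducedPath.reverse {l : List V} (h : IsInducedPath G l) :
    IsInducedPath G l.reverse := by
  induction l with
  | nil => exact h
  | cons a l ih =>
    rw [List.reverse_cons, isInducedPath_append]
    refine ⟨ih h.2.2, isInducedPath_singleton a, fun c hc b hb ↦ ?_⟩
    obtain rfl := List.mem_singleton.1 hb
    have hc : c ∈ l := List.mem_reverse.1 hc
    have hadj : G.Adj c b ↔ l.head? = some c := by rw [G.adj_comm, h.2.1 c hc]
    exact ⟨fun e ↦ h.1 (e ▸ hc), by simpa using hadj⟩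

theorem isInducedPath_of_getElem {l : List V} (hl : l.Nodup)
    (h : ∀ i j (hj : j < l.length) (hij : i < j), G.Adj (l[i]'(hij.trans hj)) l[j] ↔ j = i + 1) :
    IsInducedPath G l := by
  induction l with
  | nil => trivial
  | cons a l ih =>
    rw [List.nodup_cons] at hl
    refine ⟨hl.1, fun c hc ↦ ?_, ih hl.2 fun i j hj hij ↦ ?_⟩
    · obtain ⟨j, hj, rfl⟩ := List.getElem_of_mem hc
      have hadj : G.Adj a l[j] ↔ j = 0 :=
        (h 0 (j + 1) (Nat.succ_lt_succ hj) j.succ_pos).trans (by simp)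
      rw [hadj, List.head?_eq_getElem?, List.getElem?_eq_getElem (by omega), Option.some.injEq,
        hl.2.getElem_inj_iff, eq_comm]
    · exact (h (i + 1) (j + 1) (Nat.succ_lt_succ hj) (Nat.succ_lt_succ hij)).trans (by simp)

/-- `l` is an induced path that starts in `x` and then stays in `W`. -/
def IsInducedPathFrom (G : SimpleGraph V) (W : Finset V) (x : V) (l : List V) : Prop :=
  IsInducedPath G l ∧ l.head? = some x ∧ ∀ c ∈ l.tail, c ∈ W

open scoped Classical in
/-- The neighbours of `x` in `W`. -/
noncomputable def nbrsIn (G : SimpleGraph V) (W : Finset V) (x : V) : Finset V :=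
  W.filter (G.Adj x)

open scoped Classical in
/-- The vertices of `W` with no neighbour in the list `A`. These are the vertices a path may still
visit once it has left the last vertex of `A`. -/
noncomputable def unseen (G : SimpleGraph V) (W : Finset V) (A : List V) : Finset V :=
  W.filter fun u ↦ ∀ b ∈ A, ¬ G.Adj b u

variable {W : Finset V} {x w : V}

theorem mem_nbrsIn {u : V} : u ∈ nbrsIn G W x ↔ u ∈ W ∧ G.Adj x u := by
  simp [nbrsIn]

theorem mem_unseen {A : List V} {u : V} :
    u ∈ unseen G W A ↔ u ∈ W ∧ ∀ b ∈ A, ¬ G.Adj b u := by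
  simp [unseen]

theorem mem_unseen_singleton {u : V} : u ∈ unseen G W [x] ↔ u ∈ W ∧ ¬ G.Adj x u := by
  simp [mem_unseen]

theorem unseen_subset (A : List V) : unseen G W A ⊆ W :=
  fun _ hu ↦ (mem_unseen.1 hu).1

@[simp] theorem unseen_nil : unseen G W [] = W := by simp [unseen]

theorem unseen_append (A B : List V) : unseen G W (A ++ B) = unseen G (unseen G W A) B := by
  ext u
  simp only [mem_unseen, List.mem_append]
  grind

theorem unseen_cons (a : V) (B : List V) :
    unseen G W (a :: B) = unseen G (unseen G W [a]) B := unseen_append [a] B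

theorem notMem_unseen_of_mem_nbrsIn {v : V} (hv : v ∈ nbrsIn G W x) : v ∉ unseen G W [x] :=
  fun h ↦ (mem_unseen_singleton.1 h).2 (mem_nbrsIn.1 hv).2

theorem sdiff_nbrsIn [DecidableEq V] : W \ nbrsIn G W x = unseen G W [x] := by
  ext u
  simp only [Finset.mem_sdiff, mem_nbrsIn, mem_unseen_singleton]
  tauto

theorem card_unseen_add_card_nbrsIn : (unseen G W [x]).card + (nbrsIn G W x).card = W.card := by
  classical
  rw [← sdiff_nbrsIn]
  exact Finset.card_sdiff_add_card_eq_card fun _ hu ↦ (mem_nbrsIn.1 hu).1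

theorem isInducedPathFrom_singleton : IsInducedPathFrom G W x [x] :=
  ⟨isInducedPath_singleton x, rfl, by simp⟩

theorem isInducedPathFrom_pair {v : V} (hv : v ∈ nbrsIn G W x) :
    IsInducedPathFrom G W x ([x] ++ [v]) := by
  obtain ⟨hvW, hadj⟩ := mem_nbrsIn.1 hv
  exact ⟨⟨by simpa using hadj.ne, by simpa using hadj, isInducedPath_singleton v⟩, rfl,
    by simpa using hvW⟩

theorem IsInducedPathFrom.exists_eq_cons {l : List V} (h : IsInducedPathFrom G W x l) :
    ∃ T, l = x :: T :=
  ⟨l.tail, List.eq_cons_of_mem_head? h.2.1⟩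

theorem IsInducedPathFrom.of_append {A B : List V} (hA : A ≠ [])
    (h : IsInducedPathFrom G W x (A ++ B)) : IsInducedPathFrom G W x A := by
  obtain ⟨a, A, rfl⟩ := List.exists_cons_of_ne_nil hA
  exact ⟨(isInducedPath_append.1 h.1).1, h.2.1, fun c hc ↦ h.2.2 c (List.mem_append_left B hc)⟩

theorem IsInducedPathFrom.take {l : List V} {n : ℕ} (hn : n ≠ 0)
    (h : IsInducedPathFrom G W x l) : IsInducedPathFrom G W x (l.take n) := by
  obtain ⟨T, rfl⟩ := h.exists_eq_cons
  refine IsInducedPathFrom.of_append (B := (x :: T).drop n) (by simp [hn]) ?_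
  rwa [List.take_append_drop]

theorem IsInducedPathFrom.notMem_unseen (hx : x ∉ W) {A : List V} {a : V}
    (h : IsInducedPathFrom G W x (A ++ [a])) : ∀ c ∈ A ++ [a], c ∉ unseen G W A := by
  induction A using List.reverseRecOn generalizing a with
  | nil =>
    obtain rfl : a = x := by simpa using h.2.1
    simpa using hx
  | append_singleton A b ih =>
    intro c hc hcu
    rw [unseen_append] at hcu
    rcases List.mem_append.1 hc with hc | hc
    · exact ih (h.of_append (by simp)) c hc (unseen_subset _ hcu)
    · obtain rfl := List.mem_singleton.1 hc
      have hadj : G.Adj b c :=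
        ((isInducedPath_append.1 h.1).2.2 b (by simp) c (by simp)).2.2 (by simp)
      exact (mem_unseen_singleton.1 hcu).2 hadj

theorem IsInducedPathFrom.append_iff (hx : x ∉ W) {A T : List V} {a : V}
    (h : IsInducedPathFrom G W x (A ++ [a])) :
    IsInducedPathFrom G W x (A ++ a :: T) ↔ IsInducedPathFrom G (unseen G W A) a (a :: T) := by
  have hunseen := h.notMem_unseen hx
  obtain ⟨hpath, hhead, htail⟩ := h
  obtain ⟨hA, -, hAa⟩ := isInducedPath_append.1 hpath
  have hhead' : (A ++ a :: T).head? = some x := by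
    cases A <;> simpa using hhead
  have htail' : (∀ c ∈ (A ++ a :: T).tail, c ∈ W) ↔ ∀ c ∈ T, c ∈ W := by
    cases A <;> grind
  simp only [IsInducedPathFrom, isInducedPath_append, List.head?_cons, List.tail_cons, hhead',
    htail', mem_unseen, true_and, hA]
  constructor
  · rintro ⟨⟨hT, hcross⟩, hW⟩
    refine ⟨hT, fun c hc ↦ ⟨hW c hc, fun b hb hadj ↦ ?_⟩⟩
    have := (hcross b hb c (List.mem_cons_of_mem a hc)).2.1 hadj
    exact hT.1 ((Option.some.inj this.2) ▸ hc)
  · rintro ⟨hT, hW⟩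
    refine ⟨⟨hT, fun b hb c hc ↦ ?_⟩, fun c hc ↦ (hW c hc).1⟩
    rcases List.mem_cons.1 hc with rfl | hc
    · simpa using hAa b hb c (by simp)
    · have hbc : b ≠ c := fun e ↦ hunseen b (List.mem_append_left _ hb) (e ▸ mem_unseen.2 (hW c hc))
      have hac : a ≠ c := fun e ↦ hT.1 (e ▸ hc)
      simpa [hac, hbc] using (hW c hc).2 b hb

theorem IsInducedPathFrom.snoc (hx : x ∉ W) {A : List V} {a b : V}
    (h : IsInducedPathFrom G W x (A ++ [a])) (hb : b ∈ nbrsIn G (unseen G W A) a) :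
    IsInducedPathFrom G W x (A ++ [a] ++ [b]) := by
  rw [List.append_assoc]
  exact (h.append_iff hx).2 (isInducedPathFrom_pair hb)

theorem IsInducedPathFrom.mem_nbrsIn_of_append (hx : x ∉ W) {A T : List V} {a b : V}
    (h : IsInducedPathFrom G W x (A ++ a :: b :: T)) : b ∈ nbrsIn G (unseen G W A) a := by
  have hA : IsInducedPathFrom G W x (A ++ [a]) :=
    IsInducedPathFrom.of_append (B := b :: T) (by simp) (by simpa using h)
  obtain ⟨hpath, -, htail⟩ := (hA.append_iff hx).1 h
  exact mem_nbrsIn.2 ⟨htail b (by simp), (hpath.2.1 b (by simp)).2 rfl⟩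

end

section

variable {V : Type*} {G : SimpleGraph V} {W : Finset V} {x w : V}

/-- The induced paths of `G` from `x` to `w` that stay in `W` after their first vertex. -/
noncomputable def inducedPaths (G : SimpleGraph V) (w : V) (W : Finset V) (x : V) :
    Finset (List V) :=
  Set.Finite.toFinset (s := {l | IsInducedPathFrom G W x l ∧ l.getLast? = some w}) <| by
    classical
    refine Set.Finite.subset (Set.finite_range
      fun l : {l : List ↥(insert x W) // l.Nodup} ↦ l.1.map Subtype.val) ?_
    rintro l ⟨h, -⟩
    obtain ⟨T, rfl⟩ := h.exists_eq_cons
    obtain ⟨l', hl'⟩ : x :: T ∈ Set.range (List.map (Subtype.val : ↥(insert x W) → V)) := by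
      rw [Set.range_list_map]
      simpa using fun c hc ↦ Or.inr (h.2.2 c hc)
    exact ⟨⟨l', .of_map _ (hl' ▸ h.1.nodup)⟩, hl'⟩

theorem mem_inducedPaths {l : List V} :
    l ∈ inducedPaths G w W x ↔ IsInducedPathFrom G W x l ∧ l.getLast? = some w := by
  simp [inducedPaths]

theorem exists_eq_cons_of_mem_inducedPaths {l : List V} (hl : l ∈ inducedPaths G w W x) :
    ∃ T, l = x :: T :=
  (mem_inducedPaths.1 hl).1.exists_eq_cons

theorem append_mem_inducedPaths (hx : x ∉ W) {A T : List V} {a : V}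
    (h : IsInducedPathFrom G W x (A ++ [a])) :
    A ++ a :: T ∈ inducedPaths G w W x ↔ a :: T ∈ inducedPaths G w (unseen G W A) a := by
  rw [mem_inducedPaths, mem_inducedPaths, h.append_iff hx]
  simp [List.getLast?_append]

theorem inducedPaths_self (hw : w ∉ W) : inducedPaths G w W w = {[w]} := by
  ext l
  rw [mem_inducedPaths, Finset.mem_singleton]
  refine ⟨?_, fun h ↦ h ▸ ⟨isInducedPathFrom_singleton, rfl⟩⟩
  rintro ⟨h, hlast⟩
  obtain ⟨_ | ⟨b, T⟩, rfl⟩ := h.exists_eq_cons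
  · rfl
  · rw [List.getLast?_cons_cons] at hlast
    exact absurd (h.2.2 w (List.mem_of_getLast? hlast)) hw

theorem inducedPaths_eq_empty (hxw : x ≠ w) (hw : w ∉ W) : inducedPaths G w W x = ∅ := by
  refine Finset.eq_empty_of_forall_notMem fun l hl ↦ ?_
  obtain ⟨h, hlast⟩ := mem_inducedPaths.1 hl
  obtain ⟨_ | ⟨b, T⟩, rfl⟩ := h.exists_eq_cons
  · exact hxw (by simpa using hlast)
  · rw [List.getLast?_cons_cons] at hlast
    exact hw (h.2.2 w (List.mem_of_getLast? hlast))

theorem inducedPaths_eq_biUnion [DecidableEq V] (hx : x ∉ W) (hxw : x ≠ w) :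
    inducedPaths G w W x =
      (nbrsIn G W x).biUnion fun v ↦ (inducedPaths G w (unseen G W [x]) v).image (List.cons x) := by
  ext l
  simp only [Finset.mem_biUnion, Finset.mem_image]
  constructor
  · intro hl
    obtain ⟨h, hlast⟩ := mem_inducedPaths.1 hl
    obtain ⟨_ | ⟨b, T⟩, rfl⟩ := h.exists_eq_cons
    · exact absurd (by simpa using hlast) hxw
    · have hb : b ∈ nbrsIn G W x :=
        mem_nbrsIn.2 ⟨h.2.2 b (by simp), (h.1.2.1 b (by simp)).2 rfl⟩
      exact ⟨b, hb, b :: T,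
        (append_mem_inducedPaths (A := [x]) hx (isInducedPathFrom_pair hb)).1 hl, rfl⟩
  · rintro ⟨v, hv, T, hT, rfl⟩
    obtain ⟨T, rfl⟩ := exists_eq_cons_of_mem_inducedPaths hT
    exact (append_mem_inducedPaths (A := [x]) hx (isInducedPathFrom_pair hv)).2 hT

theorem sum_inducedPaths {M : Type*} [AddCommMonoid M] (hx : x ∉ W) (hxw : x ≠ w)
    (f : List V → M) :
    ∑ l ∈ inducedPaths G w W x, f l =
      ∑ v ∈ nbrsIn G W x, ∑ l ∈ inducedPaths G w (unseen G W [x]) v, f (x :: l) := by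
  classical
  rw [inducedPaths_eq_biUnion hx hxw, Finset.sum_biUnion]
  · exact Finset.sum_congr rfl fun v _ ↦ Finset.sum_image fun _ _ _ _ h ↦ List.tail_eq_of_cons_eq h
  · refine fun v _ v' _ hne ↦ Finset.disjoint_left.2 fun l hl hl' ↦ hne ?_
    obtain ⟨T, hT, rfl⟩ := Finset.mem_image.1 hl
    obtain ⟨T', hT', hcons⟩ := Finset.mem_image.1 hl'
    obtain rfl := List.tail_eq_of_cons_eq hcons
    exact Option.some.inj ((mem_inducedPaths.1 hT).1.2.1.symm.trans (mem_inducedPaths.1 hT').1.2.1)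

theorem card_inducedPaths (hx : x ∉ W) (hxw : x ≠ w) :
    (inducedPaths G w W x).card =
      ∑ v ∈ nbrsIn G W x, (inducedPaths G w (unseen G W [x]) v).card := by
  simp only [Finset.card_eq_sum_ones]
  exact sum_inducedPaths hx hxw fun _ ↦ 1

theorem filter_notMem_inducedPaths [DecidableEq V] {y : V} (hy : y ∈ W) (hx : x ∉ W) :
    {l ∈ inducedPaths G w W x | y ∉ l} = inducedPaths G w (W.erase y) x := by
  ext l
  simp only [Finset.mem_filter, mem_inducedPaths]
  refine ⟨fun ⟨⟨h, hlast⟩, hyl⟩ ↦ ⟨⟨h.1, h.2.1, fun c hc ↦ Finset.mem_erase.2 ⟨?_, h.2.2 c hc⟩⟩,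
    hlast⟩, fun ⟨h, hlast⟩ ↦ ⟨⟨⟨h.1, h.2.1, fun c hc ↦ Finset.mem_of_mem_erase (h.2.2 c hc)⟩,
    hlast⟩, fun hyl ↦ ?_⟩⟩
  · rintro rfl
    exact hyl (List.mem_of_mem_tail hc)
  · obtain ⟨T, rfl⟩ := h.exists_eq_cons
    rcases List.mem_cons.1 hyl with rfl | hyT
    · exact hx hy
    · exact Finset.notMem_erase y W (h.2.2 y hyT)

theorem reverse_mem_inducedPaths [DecidableEq V] {l : List V} (hl : l ∈ inducedPaths G w W x) :
    l.reverse ∈ inducedPaths G x (insert x (W.erase w)) w := by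
  obtain ⟨h, hlast⟩ := mem_inducedPaths.1 hl
  obtain ⟨l', rfl⟩ := List.getLast?_eq_some_iff.1 hlast
  refine mem_inducedPaths.2 ⟨⟨h.1.reverse, by simp, fun c hc ↦ ?_⟩,
    by rw [List.getLast?_reverse, h.2.1]⟩
  have hcl' : c ∈ l' := by simpa using hc
  have hcw : c ≠ w := by
    rintro rfl
    exact List.disjoint_of_nodup_append h.1.nodup hcl' (List.mem_singleton_self c)
  rw [Finset.mem_insert, Finset.mem_erase]
  obtain ⟨T, hT⟩ := h.exists_eq_cons
  have hcT : c ∈ x :: T := hT ▸ List.mem_append_left _ hcl'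
  rcases List.mem_cons.1 hcT with hcx | hcT
  · exact .inl hcx
  · exact .inr ⟨hcw, h.2.2 c (hT ▸ hcT)⟩

open scoped Classical in
/-- The number of induced paths from `x` to `w` through `W` with the property `p`. -/
noncomputable def countPaths (G : SimpleGraph V) (w : V) (W : Finset V) (x : V)
    (p : List V → Prop) : ℕ :=
  {l ∈ inducedPaths G w W x | p l}.card

section countPaths

variable {p q : List V → Prop}

theorem countPaths_eq_card_filter [DecidablePred p] :
    countPaths G w W x p = {l ∈ inducedPaths G w W x | p l}.card := by
  rw [countPaths]
  congr

theorem countPaths_pos : 0 < countPaths G w W x p ↔ ∃ l ∈ inducedPaths G w W x, p l := by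
  classical
  rw [countPaths_eq_card_filter, Finset.card_pos, Finset.filter_nonempty_iff]

theorem countPaths_true : countPaths G w W x (fun _ ↦ True) = (inducedPaths G w W x).card := by
  simp [countPaths]

theorem countPaths_mono (h : ∀ l ∈ inducedPaths G w W x, p l → q l) :
    countPaths G w W x p ≤ countPaths G w W x q := by
  classical
  refine Finset.card_le_card fun l hl ↦ ?_
  rw [Finset.mem_filter] at hl ⊢
  exact ⟨hl.1, h l hl.1 hl.2⟩

theorem countPaths_add_countPaths_not :
    countPaths G w W x p + countPaths G w W x (fun l ↦ ¬ p l) = (inducedPaths G w W x).card := by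
  classical
  simp only [countPaths_eq_card_filter, Finset.card_filter_add_card_filter_not]

theorem countPaths_or_le :
    countPaths G w W x (fun l ↦ p l ∨ q l) ≤ countPaths G w W x p + countPaths G w W x q := by
  classical
  simp only [countPaths_eq_card_filter, Finset.filter_or]
  exact Finset.card_union_le _ _

theorem countPaths_exists_mem_le {ι : Type*} (s : Finset ι) (P : ι → List V → Prop) :
    countPaths G w W x (fun l ↦ ∃ i ∈ s, P i l) ≤ ∑ i ∈ s, countPaths G w W x (P i) := by
  classical
  refine (Finset.card_le_card fun l hl ↦ ?_).trans Finset.card_biUnion_le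
  simp only [Finset.mem_filter, Finset.mem_biUnion] at hl ⊢
  obtain ⟨hl, i, hi, hP⟩ := hl
  exact ⟨i, hi, hl, hP⟩

theorem countPaths_prefix_and (hx : x ∉ W) {A : List V} {a : V}
    (h : IsInducedPathFrom G W x (A ++ [a])) (p : List V → Prop) :
    countPaths G w W x (fun l ↦ A ++ [a] <+: l ∧ p l) =
      countPaths G w (unseen G W A) a fun T ↦ p (A ++ T) := by
  classical
  simp only [countPaths_eq_card_filter]
  symm
  refine Finset.card_bij (fun T _ ↦ A ++ T) ?_ (fun T _ T' _ e ↦ List.append_cancel_left e) ?_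
  · intro T hT
    obtain ⟨hT, hp⟩ := Finset.mem_filter.1 hT
    obtain ⟨T, rfl⟩ := exists_eq_cons_of_mem_inducedPaths hT
    exact Finset.mem_filter.2 ⟨(append_mem_inducedPaths hx h).2 hT, ⟨T, by simp⟩, hp⟩
  · intro l hl
    obtain ⟨hl, ⟨T, rfl⟩, hp⟩ := Finset.mem_filter.1 hl
    rw [List.append_assoc, List.singleton_append] at hl hp
    exact ⟨a :: T, Finset.mem_filter.2 ⟨(append_mem_inducedPaths hx h).1 hl, hp⟩, by simp⟩

theorem countPaths_prefix (hx : x ∉ W) {A : List V} {a : V}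
    (h : IsInducedPathFrom G W x (A ++ [a])) :
    countPaths G w W x (A ++ [a] <+: ·) = (inducedPaths G w (unseen G W A) a).card := by
  rw [← countPaths_true, ← countPaths_prefix_and hx h fun _ ↦ True]
  simp only [and_true]

theorem sum_countPaths_and_le {ι : Type*} {s : Finset ι} {r : ι → List V → Prop}
    [∀ i, DecidablePred (r i)] {c : ℕ}
    (h : ∀ l ∈ inducedPaths G w W x, p l → {i ∈ s | r i l}.card ≤ c) :
    ∑ i ∈ s, countPaths G w W x (fun l ↦ r i l ∧ p l) ≤ c * countPaths G w W x p := by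
  classical
  have hfilter (i : ι) : countPaths G w W x (fun l ↦ r i l ∧ p l) =
      (Finset.bipartiteAbove r {l ∈ inducedPaths G w W x | p l} i).card := by
    rw [Finset.bipartiteAbove, Finset.filter_filter, countPaths_eq_card_filter]
    simp only [and_comm]
  simp only [hfilter]
  rw [Finset.sum_card_bipartiteAbove_eq_sum_card_bipartiteBelow, mul_comm,
    countPaths_eq_card_filter]
  refine Finset.sum_le_card_nsmul _ _ c fun l hl ↦ ?_
  exact h l (Finset.mem_filter.1 hl).1 (Finset.mem_filter.1 hl).2

theorem sum_countPaths_prefix_and_le {t : Finset (List V)} {n : ℕ} (ht : ∀ σ ∈ t, σ.length = n) :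
    ∑ σ ∈ t, countPaths G w W x (fun l ↦ σ <+: l ∧ p l) ≤ countPaths G w W x p := by
  classical
  rw [← one_mul (countPaths G w W x p)]
  refine sum_countPaths_and_le fun l _ _ ↦ Finset.card_le_one.2 fun σ hσ σ' hσ' ↦ ?_
  obtain ⟨hσ, hpre⟩ := Finset.mem_filter.1 hσ
  obtain ⟨hσ', hpre'⟩ := Finset.mem_filter.1 hσ'
  rw [List.prefix_iff_eq_take.1 hpre, List.prefix_iff_eq_take.1 hpre', ht σ hσ, ht σ' hσ']

open scoped Classical in
/-- The initial segments of length `n` of the induced paths from `x` to `w` through `W` with the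
property `p`. -/
noncomputable def initialSegments (G : SimpleGraph V) (w : V) (W : Finset V) (x : V)
    (p : List V → Prop) (n : ℕ) : Finset (List V) :=
  {l ∈ inducedPaths G w W x | p l}.image (List.take n)

theorem mem_initialSegments {n : ℕ} {σ : List V} :
    σ ∈ initialSegments G w W x p n ↔ ∃ l ∈ inducedPaths G w W x, p l ∧ l.take n = σ := by
  simp [initialSegments, and_assoc]

theorem countPaths_le_sum_initialSegments (n : ℕ) :
    countPaths G w W x p ≤
      ∑ σ ∈ initialSegments G w W x p n, countPaths G w W x (σ <+: ·) := by
  classical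
  refine le_trans ?_ (countPaths_exists_mem_le _ fun σ l ↦ σ <+: l)
  exact countPaths_mono fun l hl hp ↦
    ⟨l.take n, mem_initialSegments.2 ⟨l, hl, hp, rfl⟩, List.take_prefix n l⟩

end countPaths

end

/-! ### The number of induced paths -/

section

/-- The cube root of three, the growth rate of the number of induced paths and cycles. -/
noncomputable def cbrtThree : ℝ := (3 : ℝ) ^ ((1 : ℝ) / 3)

theorem cbrtThree_pow_three : cbrtThree ^ 3 = 3 := by
  rw [cbrtThree, ← Real.rpow_natCast, ← Real.rpow_mul (by norm_num)]
  norm_num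

theorem cbrtThree_pos : 0 < cbrtThree := Real.rpow_pos_of_pos (by norm_num) _

theorem le_cbrtThree {a : ℝ} (h : a ^ 3 ≤ 3) : a ≤ cbrtThree :=
  le_of_pow_le_pow_left₀ (n := 3) (by norm_num) cbrtThree_pos.le (by rwa [cbrtThree_pow_three])

theorem one_lt_cbrtThree : 1 < cbrtThree :=
  lt_of_lt_of_le (by norm_num) (le_cbrtThree (a := 1.44) (by norm_num))

/- The inequality `d ≤ 3 ^ (d / 3)` is strict unless `d = 3`; any base between `1` and `1.04`
would do in place of `1.03`. -/
theorem mul_pow_dist_le_cbrtThree_pow (d : ℕ) :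
    (d : ℝ) * 1.03 ^ Nat.dist d 3 ≤ cbrtThree ^ d := by
  have hpos := cbrtThree_pos
  have hlow : (1.44 : ℝ) ≤ cbrtThree := le_cbrtThree (by norm_num)
  rcases lt_or_ge d 3 with h | h
  · rw [Nat.dist_eq_sub_of_le h.le]
    refine le_trans ?_ (pow_le_pow_left₀ (by norm_num) hlow d)
    interval_cases d <;> norm_num
  · rw [Nat.dist_eq_sub_of_le_right h]
    induction d, h using Nat.le_induction with
    | base => norm_num [cbrtThree_pow_three]
    | succ d hd ih =>
      have hd' : (3 : ℝ) ≤ d := by exact_mod_cast hd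
      rw [Nat.succ_sub hd, Nat.cast_succ, pow_succ, pow_succ]
      calc ((d : ℝ) + 1) * (1.03 ^ (d - 3) * 1.03)
          = ((d + 1) * 1.03) * 1.03 ^ (d - 3) := by ring
        _ ≤ (d * 1.44) * 1.03 ^ (d - 3) := by gcongr ?_ * _; linarith
        _ = (d * 1.03 ^ (d - 3)) * 1.44 := by ring
        _ ≤ cbrtThree ^ d * cbrtThree := by gcongr

variable {V : Type*} {G : SimpleGraph V} {W : Finset V} {x w : V}

open scoped Classical in
/-- The vertices of `W` with a neighbour in the list `A`. -/
noncomputable def seen (G : SimpleGraph V) (W : Finset V) (A : List V) : Finset V :=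
  W.filter fun u ↦ ∃ b ∈ A, G.Adj b u

theorem mem_seen {A : List V} {u : V} : u ∈ seen G W A ↔ u ∈ W ∧ ∃ b ∈ A, G.Adj b u := by
  simp [seen]

theorem card_seen_add_card_unseen (A : List V) :
    (seen G W A).card + (unseen G W A).card = W.card := by
  classical
  rw [← Finset.card_filter_add_card_filter_not (s := W) fun u ↦ ∃ b ∈ A, G.Adj b u]
  congr 2
  ext u
  simp [mem_unseen]

theorem seen_append [DecidableEq V] (A B : List V) :
    seen G W (A ++ B) = seen G W A ∪ seen G W B := by
  ext u
  simp only [mem_seen, List.mem_append, Finset.mem_union]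
  grind

/-- How far a path is from seeing three new vertices of `W` in every step and leaving no vertex
of `W` unseen. The last vertex of the path is charged with everything that is then still unseen. -/
noncomputable def defect (G : SimpleGraph V) : Finset V → List V → ℕ
  | _, [] => 0
  | W, [_] => W.card
  | W, a :: b :: l => Nat.dist (nbrsIn G W a).card 3 + defect G (unseen G W [a]) (b :: l)

/-- The number of vertices of `W` with neighbours both among the first `k` and among the other
vertices of the path `l`. -/
noncomputable def straddleCount (G : SimpleGraph V) (W : Finset V) (k : ℕ) (l : List V) : ℕ := by
  classical
  exact (seen G W (l.take k) ∩ seen G W (l.drop k)).card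

theorem card_seen_take_le (W : Finset V) (k : ℕ) (l : List V) :
    (seen G W (l.take k)).card ≤ 3 * k + defect G W l := by
  have hcard (W' : Finset V) (A : List V) := card_seen_add_card_unseen (G := G) (W := W') A
  induction k generalizing W l with
  | zero => simp [seen]
  | succ k ih =>
    rcases l with _ | ⟨a, _ | ⟨b, l⟩⟩
    · simp [seen]
    · have := hcard W ([a].take (k + 1))
      rw [defect]
      omega
    · have hW := hcard W ((a :: b :: l).take (k + 1))
      have hW' := hcard (unseen G W [a]) ((b :: l).take k)
      have hstep := card_unseen_add_card_nbrsIn (G := G) (W := W) (x := a)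
      have := ih (unseen G W [a]) (b :: l)
      rw [List.take_succ_cons, unseen_cons] at hW
      rw [List.take_succ_cons, defect, Nat.dist]
      omega

theorem three_mul_length_le (W : Finset V) {l : List V} (hl : l ≠ []) :
    3 * l.length ≤ W.card + defect G W l + 3 := by
  induction l generalizing W with
  | nil => exact absurd rfl hl
  | cons a l ih =>
    rcases l with _ | ⟨b, l⟩
    · simp
    · have hrec := ih (unseen G W [a]) (by simp)
      have hstep := card_unseen_add_card_nbrsIn (G := G) (W := W) (x := a)
      rw [defect, List.length_cons, Nat.dist]
      omega

theorem card_unseen_le_defect (W : Finset V) {l : List V} (hl : l ≠ []) :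
    (unseen G W l).card ≤ defect G W l := by
  induction l generalizing W with
  | nil => exact absurd rfl hl
  | cons a l ih =>
    rcases l with _ | ⟨b, l⟩
    · exact Finset.card_le_card (unseen_subset _)
    · rw [unseen_cons, defect]
      exact (ih _ (by simp)).trans (Nat.le_add_left _ _)

theorem card_insert_erase_eq [DecidableEq V] (hx : x ∉ W) (hw : w ∈ W) :
    (insert x (W.erase w)).card = W.card := by
  rw [Finset.card_insert_of_notMem fun h ↦ hx (Finset.mem_of_mem_erase h),
    Finset.card_erase_add_one hw]

theorem seen_drop_subset [DecidableEq V] {l : List V} {k : ℕ} (hk : k ≤ l.length) :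
    seen G W (l.drop k) ⊆
      insert w (seen G (insert x (W.erase w)) (l.reverse.take (l.length - k))) := by
  intro z hz
  obtain ⟨hzW, hb⟩ := mem_seen.1 hz
  rw [List.take_reverse, Nat.sub_sub_self hk, Finset.mem_insert, mem_seen]
  by_cases hzw : z = w
  · exact .inl hzw
  · exact .inr ⟨Finset.mem_insert_of_mem (Finset.mem_erase.2 ⟨hzw, hzW⟩), by simpa using hb⟩

/- The first `k` vertices see about `3 k` vertices of `W`, and in reverse the others see about
`3 (l.length - k)`; both numbers add up to about `W.card`, so the overlap is small. -/
theorem straddleCount_le_defect [DecidableEq V] (x w : V) {l : List V} (hl : l ≠ []) (k : ℕ) :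
    straddleCount G W k l ≤
      3 * defect G W l + defect G (insert x (W.erase w)) l.reverse + 4 := by
  rcases le_or_gt l.length k with hk | hk
  · simp [straddleCount, List.drop_eq_nil_of_le hk, seen]
  have hfront : (seen G W (l.take k)).card ≤ 3 * k + defect G W l := card_seen_take_le W k l
  have hback : (seen G W (l.drop k)).card ≤
      3 * (l.length - k) + defect G (insert x (W.erase w)) l.reverse + 1 :=
    (Finset.card_le_card (seen_drop_subset hk.le)).trans <|
      (Finset.card_insert_le _ _).trans (Nat.add_le_add_right (card_seen_take_le _ _ _) 1)
  have hall := card_seen_add_card_unseen (G := G) (W := W) l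
  nth_rw 1 [← List.take_append_drop k l] at hall
  rw [seen_append] at hall
  have hunseen := card_unseen_le_defect (G := G) W hl
  have hlength := three_mul_length_le (G := G) W hl
  have hinter := Finset.card_union_add_card_inter (seen G W (l.take k)) (seen G W (l.drop k))
  have hstraddle : straddleCount G W k l = (seen G W (l.take k) ∩ seen G W (l.drop k)).card := by
    rw [straddleCount]
    congr!
  omega

theorem sum_pow_defect_le (hx : x ∉ W) :
    ∑ l ∈ inducedPaths G w W x, (1.03 : ℝ) ^ defect G W l ≤ cbrtThree ^ W.card := by
  induction hn : W.card using Nat.strong_induction_on generalizing W x with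
  | _ n ih =>
  rcases eq_or_ne x w with rfl | hxw
  · rw [inducedPaths_self hx, Finset.sum_singleton, defect, hn]
    exact pow_le_pow_left₀ (by norm_num) (le_cbrtThree (by norm_num)) _
  set d := (nbrsIn G W x).card
  have hcard : (unseen G W [x]).card + d = W.card := card_unseen_add_card_nbrsIn
  have hbranch : ∀ v ∈ nbrsIn G W x, ∑ l ∈ inducedPaths G w (unseen G W [x]) v,
      (1.03 : ℝ) ^ defect G W (x :: l) ≤ 1.03 ^ Nat.dist d 3 * cbrtThree ^ (n - d) := by
    intro v hv
    have hd0 : 0 < d := Finset.card_pos.2 ⟨v, hv⟩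
    have hrec := ih (n - d) (by omega) (notMem_unseen_of_mem_nbrsIn hv) (by omega)
    refine le_trans (le_of_eq ?_) (mul_le_mul_of_nonneg_left hrec (by positivity))
    rw [Finset.mul_sum]
    refine Finset.sum_congr rfl fun l hl ↦ ?_
    obtain ⟨T, rfl⟩ := exists_eq_cons_of_mem_inducedPaths hl
    rw [defect, pow_add]
  calc ∑ l ∈ inducedPaths G w W x, (1.03 : ℝ) ^ defect G W l
      = ∑ v ∈ nbrsIn G W x, ∑ l ∈ inducedPaths G w (unseen G W [x]) v,
          (1.03 : ℝ) ^ defect G W (x :: l) := sum_inducedPaths hx hxw _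
    _ ≤ d * (1.03 ^ Nat.dist d 3 * cbrtThree ^ (n - d)) := by
        simpa using Finset.sum_le_card_nsmul _ _ _ hbranch
    _ = d * 1.03 ^ Nat.dist d 3 * cbrtThree ^ (n - d) := (mul_assoc _ _ _).symm
    _ ≤ cbrtThree ^ d * cbrtThree ^ (n - d) :=
        mul_le_mul_of_nonneg_right (mul_pow_dist_le_cbrtThree_pow d) (pow_nonneg cbrtThree_pos.le _)
    _ = cbrtThree ^ n := by rw [← pow_add, Nat.add_sub_cancel' (by omega)]

theorem card_inducedPaths_le (hx : x ∉ W) :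
    ((inducedPaths G w W x).card : ℝ) ≤ cbrtThree ^ W.card := by
  refine le_trans ?_ (sum_pow_defect_le (G := G) (w := w) hx)
  rw [Finset.card_eq_sum_ones, Nat.cast_sum, Nat.cast_one]
  exact Finset.sum_le_sum fun l _ ↦ one_le_pow₀ (by norm_num)

theorem sum_defect_le (hx : x ∉ W) :
    ∑ l ∈ inducedPaths G w W x, (defect G W l : ℝ) ≤ 100 / 3 * cbrtThree ^ W.card := by
  refine le_trans ?_ (mul_le_mul_of_nonneg_left (sum_pow_defect_le (G := G) (w := w) hx)
    (by norm_num))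
  rw [Finset.mul_sum]
  refine Finset.sum_le_sum fun l _ ↦ ?_
  have bernoulli : 1 + defect G W l * (0.03 : ℝ) ≤ (1 + 0.03) ^ defect G W l :=
    one_add_mul_le_pow (by norm_num) _
  norm_num at bernoulli ⊢
  linarith

theorem sum_defect_reverse_le [DecidableEq V] (hx : x ∉ W) (hxw : x ≠ w) (hw : w ∈ W) :
    ∑ l ∈ inducedPaths G w W x, (defect G (insert x (W.erase w)) l.reverse : ℝ) ≤
      100 / 3 * cbrtThree ^ W.card := by
  rw [← card_insert_erase_eq hx hw]
  refine le_trans ?_ (sum_defect_le (G := G) (w := x) (x := w) (by simp [hxw.symm]))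
  rw [← Finset.sum_image (s := inducedPaths G w W x) (g := List.reverse)
    (f := fun l ↦ (defect G (insert x (W.erase w)) l : ℝ)) List.reverse_injective.injOn]
  refine Finset.sum_le_sum_of_subset_of_nonneg (fun l hl ↦ ?_) fun _ _ _ ↦ Nat.cast_nonneg _
  obtain ⟨l', hl', rfl⟩ := Finset.mem_image.1 hl
  exact reverse_mem_inducedPaths hl'

theorem sum_straddleCount_le (hx : x ∉ W) (hxw : x ≠ w) (k : ℕ) :
    ∑ l ∈ inducedPaths G w W x, (straddleCount G W k l : ℝ) ≤ 138 * cbrtThree ^ W.card := by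
  classical
  by_cases hw : w ∈ W
  swap
  · simpa [inducedPaths_eq_empty hxw hw] using pow_nonneg cbrtThree_pos.le _
  have hstraddle : ∀ l ∈ inducedPaths G w W x, (straddleCount G W k l : ℝ) ≤
      3 * defect G W l + defect G (insert x (W.erase w)) l.reverse + 4 := by
    intro l hl
    obtain ⟨T, rfl⟩ := exists_eq_cons_of_mem_inducedPaths hl
    exact_mod_cast straddleCount_le_defect x w (by simp) k
  have hdefect := sum_defect_le (G := G) (w := w) hx
  have hreverse := sum_defect_reverse_le (G := G) hx hxw hw
  have hcard := card_inducedPaths_le (G := G) (w := w) hx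
  calc ∑ l ∈ inducedPaths G w W x, (straddleCount G W k l : ℝ)
      ≤ ∑ l ∈ inducedPaths G w W x,
          (3 * (defect G W l : ℝ) + defect G (insert x (W.erase w)) l.reverse + 4) :=
        Finset.sum_le_sum hstraddle
    _ = 3 * ∑ l ∈ inducedPaths G w W x, (defect G W l : ℝ) +
          ∑ l ∈ inducedPaths G w W x, (defect G (insert x (W.erase w)) l.reverse : ℝ) +
          4 * (inducedPaths G w W x).card := by
        simp only [Finset.sum_add_distrib, ← Finset.mul_sum, Finset.sum_const, nsmul_eq_mul]
        ring
    _ ≤ 138 * cbrtThree ^ W.card := by linarith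

end

/-! ### Irreducible path densities -/

section

variable {V : Type*} {G : SimpleGraph V} {W : Finset V} {x w : V}

/-- The number of induced paths from `x` to `w` through `W`, relative to the upper bound
`3 ^ (|W| / 3)` of `card_inducedPaths_le`. -/
noncomputable def pathDensity (G : SimpleGraph V) (w : V) (W : Finset V) (x : V) : ℝ :=
  (inducedPaths G w W x).card / cbrtThree ^ W.card

theorem card_inducedPaths_eq_pathDensity_mul :
    ((inducedPaths G w W x).card : ℝ) = pathDensity G w W x * cbrtThree ^ W.card :=
  (div_mul_cancel₀ _ (pow_pos cbrtThree_pos _).ne').symm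

theorem pathDensity_nonneg : 0 ≤ pathDensity G w W x :=
  div_nonneg (Nat.cast_nonneg _) (pow_nonneg cbrtThree_pos.le _)

theorem pathDensity_le_one (hx : x ∉ W) : pathDensity G w W x ≤ 1 :=
  div_le_one_of_le₀ (card_inducedPaths_le hx) (pow_nonneg cbrtThree_pos.le _)

theorem pathDensity_mul_pow_card_nbrsIn (hx : x ∉ W) (hxw : x ≠ w) :
    pathDensity G w W x * cbrtThree ^ (nbrsIn G W x).card =
      ∑ v ∈ nbrsIn G W x, pathDensity G w (unseen G W [x]) v := by
  have hpos := cbrtThree_pos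
  simp only [pathDensity]
  rw [← Finset.sum_div, card_inducedPaths hx hxw, Nat.cast_sum,
    ← card_unseen_add_card_nbrsIn (G := G) (W := W) (x := x), pow_add]
  field_simp

theorem exists_mul_pow_dist_le_pathDensity (hx : x ∉ W) (hxw : x ≠ w)
    (hr : 0 < pathDensity G w W x) :
    ∃ v ∈ nbrsIn G W x, pathDensity G w W x * 1.03 ^ Nat.dist (nbrsIn G W x).card 3 ≤
      pathDensity G w (unseen G W [x]) v := by
  have hsum := pathDensity_mul_pow_card_nbrsIn (G := G) hx hxw
  have hne : (nbrsIn G W x).Nonempty := by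
    refine Finset.nonempty_iff_ne_empty.2 fun h ↦ hr.ne' ?_
    simpa [h] using hsum
  refine Finset.exists_le_of_sum_le hne ?_
  rw [← hsum, Finset.sum_const, nsmul_eq_mul]
  calc (nbrsIn G W x).card * (pathDensity G w W x * 1.03 ^ Nat.dist (nbrsIn G W x).card 3)
      = pathDensity G w W x *
          ((nbrsIn G W x).card * 1.03 ^ Nat.dist (nbrsIn G W x).card 3) := by ring
    _ ≤ pathDensity G w W x * cbrtThree ^ (nbrsIn G W x).card :=
        mul_le_mul_of_nonneg_left (mul_pow_dist_le_cbrtThree_pow _) hr.le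

theorem exists_card_nbrsIn_le {ρ : ℝ} (hρ : 0 < ρ) :
    ∃ D : ℕ, ∀ {V : Type*} (G : SimpleGraph V) (w : V) (W : Finset V) (x : V),
      x ∉ W → x ≠ w → ρ ≤ pathDensity G w W x → (nbrsIn G W x).card ≤ D := by
  obtain ⟨n, hn⟩ := pow_unbounded_of_one_lt (1 / ρ) (show (1 : ℝ) < 1.03 by norm_num)
  refine ⟨n + 3, fun G w W x hx hxw hr ↦ ?_⟩
  obtain ⟨v, hv, hle⟩ := exists_mul_pow_dist_le_pathDensity hx hxw (hρ.trans_le hr)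
  by_contra! hlarge
  have hn' : n ≤ Nat.dist (nbrsIn G W x).card 3 := by
    rw [Nat.dist]
    omega
  have : (1 : ℝ) < 1 := calc
    1 = ρ * (1 / ρ) := (mul_one_div_cancel hρ.ne').symm
    _ < ρ * 1.03 ^ n := mul_lt_mul_of_pos_left hn hρ
    _ ≤ pathDensity G w W x * 1.03 ^ Nat.dist (nbrsIn G W x).card 3 :=
        mul_le_mul hr (pow_le_pow_right₀ (by norm_num) hn') (by positivity) pathDensity_nonneg
    _ ≤ pathDensity G w (unseen G W [x]) v := hle
    _ ≤ 1 := pathDensity_le_one (notMem_unseen_of_mem_nbrsIn hv)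
  exact lt_irrefl _ this

theorem card_nbrsIn_eq_three_of_lt (hx : x ∉ W) (hxw : x ≠ w) (hr : 0 < pathDensity G w W x)
    (h : ∀ v ∈ nbrsIn G W x,
      pathDensity G w (unseen G W [x]) v < 1.03 * pathDensity G w W x) :
    (nbrsIn G W x).card = 3 := by
  obtain ⟨v, hv, hle⟩ := exists_mul_pow_dist_le_pathDensity hx hxw hr
  by_contra hne
  have hpow : (1.03 : ℝ) ≤ 1.03 ^ Nat.dist (nbrsIn G W x).card 3 :=
    le_self_pow₀ (by norm_num) fun h ↦ hne (Nat.eq_of_dist_eq_zero h)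
  have := mul_le_mul_of_nonneg_left hpow hr.le
  linarith [h v hv]

theorem three_mul_pathDensity_sub_le {b : ℝ} {v : V} (hx : x ∉ W) (hxw : x ≠ w)
    (hthree : (nbrsIn G W x).card = 3)
    (hb : ∀ u ∈ nbrsIn G W x, pathDensity G w (unseen G W [x]) u ≤ b) (hv : v ∈ nbrsIn G W x) :
    3 * pathDensity G w W x - 2 * b ≤ pathDensity G w (unseen G W [x]) v := by
  classical
  have hsum := pathDensity_mul_pow_card_nbrsIn (G := G) hx hxw
  rw [hthree, cbrtThree_pow_three, ← Finset.add_sum_erase _ _ hv] at hsum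
  have hrest : ∑ u ∈ (nbrsIn G W x).erase v, pathDensity G w (unseen G W [x]) u ≤ 2 * b := by
    refine (Finset.sum_le_card_nsmul _ _ b fun u hu ↦ hb u (Finset.mem_of_mem_erase hu)).trans ?_
    simp [Finset.card_erase_of_mem hv, hthree]
  linarith

/- Otherwise deleting `y`, which lowers `3 ^ (|W| / 3)` by the factor `3 ^ (1 / 3) > 1.44`, would
increase the density. -/
theorem mul_card_le_countPaths_mem [DecidableEq V] {y : V} (hy : y ∈ W) (hx : x ∉ W)
    (h : pathDensity G w (W.erase y) x ≤ 1.008 * pathDensity G w W x) :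
    0.3 * ((inducedPaths G w W x).card : ℝ) ≤ countPaths G w W x (y ∈ ·) := by
  have hcount : (countPaths G w W x (y ∈ ·) : ℝ) + (inducedPaths G w (W.erase y) x).card =
      (inducedPaths G w W x).card := by
    rw [← filter_notMem_inducedPaths hy hx, ← countPaths_eq_card_filter]
    exact_mod_cast countPaths_add_countPaths_not (p := (y ∈ ·))
  set q := cbrtThree ^ (W.card - 1)
  have hq : 0 < q := pow_pos cbrtThree_pos _
  have hpow : cbrtThree ^ W.card = q * cbrtThree := by
    rw [← pow_succ, Nat.sub_add_cancel (Finset.card_pos.2 ⟨y, hy⟩)]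
  rw [card_inducedPaths_eq_pathDensity_mul (W := W.erase y), Finset.card_erase_of_mem hy] at hcount
  rw [card_inducedPaths_eq_pathDensity_mul (W := W), hpow] at hcount ⊢
  have hcbrt : (1.44 : ℝ) ≤ cbrtThree := le_cbrtThree (by norm_num)
  have hle : pathDensity G w (W.erase y) x ≤ 0.7 * (pathDensity G w W x * cbrtThree) := by
    linarith [mul_le_mul_of_nonneg_left hcbrt (pathDensity_nonneg (G := G) (w := w) (W := W)
      (x := x))]
  linarith [mul_le_mul_of_nonneg_right hle hq.le]

/-- No deletion of at most `m` vertices, combined with an arbitrary change of the starting vertex,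
increases the density of induced paths by more than a factor `1 + δ`. -/
def PathIrreducible (G : SimpleGraph V) (w : V) (W : Finset V) (x : V) (m : ℕ) (δ : ℝ) : Prop :=
  ∀ W' ⊆ W, ∀ x' ∉ W', W.card ≤ W'.card + m →
    pathDensity G w W' x' ≤ (1 + δ) * pathDensity G w W x

/-- Up to depth `M`, the tree of induced paths from `x` to `w` through `W` is ternary, its branches
carry about equally many paths, and every vertex still unseen lies on many of them. -/
structure IsTernaryTo (G : SimpleGraph V) (w : V) (W : Finset V) (x : V) (M : ℕ) : Prop where
  notMem : x ∉ W
  pos : 0 < pathDensity G w W x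
  ne : ∀ {A a}, IsInducedPathFrom G W x (A ++ [a]) → A.length ≤ M → a ≠ w
  card_nbrsIn : ∀ {A a}, IsInducedPathFrom G W x (A ++ [a]) → A.length ≤ M →
    (nbrsIn G (unseen G W A) a).card = 3
  card_unseen : ∀ {A a}, IsInducedPathFrom G W x (A ++ [a]) → A.length ≤ M →
    (unseen G W A).card + 3 * A.length = W.card
  le_pathDensity : ∀ {A a}, IsInducedPathFrom G W x (A ++ [a]) → A.length ≤ M →
    0.99 * pathDensity G w W x ≤ pathDensity G w (unseen G W A) a
  pathDensity_le : ∀ {A a}, IsInducedPathFrom G W x (A ++ [a]) → A.length ≤ M →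
    pathDensity G w (unseen G W A) a ≤ 1.01 * pathDensity G w W x
  mul_card_le : ∀ {A a}, IsInducedPathFrom G W x (A ++ [a]) → A.length ≤ M →
    ∀ y ∈ unseen G W A, 0.3 * ((inducedPaths G w (unseen G W A) a).card : ℝ) ≤
      countPaths G w (unseen G W A) a (y ∈ ·)

namespace PathIrreducible

variable {m M D : ℕ} {δ : ℝ}

theorem pathDensity_le_of_subset_unseen (hirr : PathIrreducible G w W x m δ) {A : List V}
    {k : ℕ} {W' : Finset V} {x' : V} (hcard : (unseen G W A).card + 3 * A.length = W.card)
    (hm : 3 * A.length + k ≤ m) (hW' : W' ⊆ unseen G W A) (hx' : x' ∉ W')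
    (hk : (unseen G W A).card ≤ W'.card + k) :
    pathDensity G w W' x' ≤ (1 + δ) * pathDensity G w W x :=
  hirr W' (hW'.trans (unseen_subset A)) x' hx' (by omega)

/- A vertex with a number of new neighbours other than `3` has a child of density at least `1.03`
times its own. -/
theorem card_nbrsIn_eq_three (hirr : PathIrreducible G w W x m δ) (hx : x ∉ W)
    (hr : 0 < pathDensity G w W x) (hδ : δ ≤ 1 / 1000)
    (hD : ∀ (W' : Finset V) (x' : V), x' ∉ W' → x' ≠ w →
      pathDensity G w W x / 2 ≤ pathDensity G w W' x' → (nbrsIn G W' x').card ≤ D)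
    {A : List V} {a : V} (hA : IsInducedPathFrom G W x (A ++ [a]))
    (hcard : (unseen G W A).card + 3 * A.length = W.card) (hm : 3 * A.length + D ≤ m)
    (haw : a ≠ w) (hdens : 0.999 * pathDensity G w W x ≤ pathDensity G w (unseen G W A) a) :
    (nbrsIn G (unseen G W A) a).card = 3 := by
  have ha : a ∉ unseen G W A := hA.notMem_unseen hx a (by simp)
  refine card_nbrsIn_eq_three_of_lt ha haw (by linarith) fun v hv ↦ ?_
  have hdeg := hD _ a ha haw (by linarith)
  have hstep := card_unseen_add_card_nbrsIn (G := G) (W := unseen G W A) (x := a)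
  have hle := hirr.pathDensity_le_of_subset_unseen hcard hm (unseen_subset [a])
    (notMem_unseen_of_mem_nbrsIn hv) (by omega)
  nlinarith

theorem ne_and_card_and_le (hirr : PathIrreducible G w W x m δ) (hx : x ∉ W) (hxw : x ≠ w)
    (hr : 0 < pathDensity G w W x) (hδ : 0 < δ) (hM : 3 ^ (M + 1) * δ ≤ 1 / 1000)
    (hm : 3 * M + D + 3 ≤ m)
    (hD : ∀ (W' : Finset V) (x' : V), x' ∉ W' → x' ≠ w →
      pathDensity G w W x / 2 ≤ pathDensity G w W' x' → (nbrsIn G W' x').card ≤ D)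
    {A : List V} {a : V} (hA : IsInducedPathFrom G W x (A ++ [a])) (hAM : A.length ≤ M) :
    a ≠ w ∧ (unseen G W A).card + 3 * A.length = W.card ∧
      (1 + δ - 3 ^ A.length * δ) * pathDensity G w W x ≤ pathDensity G w (unseen G W A) a := by
  have hpow : ∀ k ≤ M + 1, (3 : ℝ) ^ k * δ ≤ 1 / 1000 := fun k hk ↦
    (mul_le_mul_of_nonneg_right (pow_le_pow_right₀ (by norm_num) hk) hδ.le).trans hM
  induction A using List.reverseRecOn generalizing a with
  | nil =>
    obtain rfl : a = x := by simpa using hA.2.1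
    simpa using hxw
  | append_singleton A b ih =>
    rw [List.length_append, List.length_singleton] at hAM ⊢
    have hb : IsInducedPathFrom G W x (A ++ [b]) := hA.of_append (by simp)
    obtain ⟨hbw, hcard, hdens⟩ := ih hb (by omega)
    have hbmem : b ∉ unseen G W A := hb.notMem_unseen hx b (by simp)
    have hthree := hirr.card_nbrsIn_eq_three hx hr (by simpa using hpow 0 (by omega)) hD hb hcard
      (by omega) hbw (by nlinarith [hpow A.length (by omega)])
    have hstep := card_unseen_add_card_nbrsIn (G := G) (W := unseen G W A) (x := b)
    have hup : ∀ v ∈ nbrsIn G (unseen G W A) b, pathDensity G w (unseen G (unseen G W A) [b]) v ≤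
        (1 + δ) * pathDensity G w W x := fun v hv ↦
      hirr.pathDensity_le_of_subset_unseen (k := 3) hcard (by omega) (unseen_subset [b])
        (notMem_unseen_of_mem_nbrsIn hv) (by omega)
    have hlow : ∀ v ∈ nbrsIn G (unseen G W A) b, (1 + δ - 3 ^ (A.length + 1) * δ) *
        pathDensity G w W x ≤ pathDensity G w (unseen G (unseen G W A) [b]) v := fun v hv ↦ by
      have := three_mul_pathDensity_sub_le hbmem hbw hthree hup hv
      rw [pow_succ]
      linarith
    have ha : a ∈ nbrsIn G (unseen G W A) b :=
      IsInducedPathFrom.mem_nbrsIn_of_append hx (T := []) (by simpa using hA)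
    rw [unseen_append]
    refine ⟨?_, by omega, hlow a ha⟩
    rintro rfl
    obtain ⟨v, hv, hva⟩ := Finset.exists_mem_ne (s := nbrsIn G (unseen G W A) b) (by omega) a
    have hzero : pathDensity G a (unseen G (unseen G W A) [b]) v = 0 := by
      simp [pathDensity, inducedPaths_eq_empty hva (notMem_unseen_of_mem_nbrsIn ha)]
    nlinarith [hlow v hv, hpow (A.length + 1) (by omega)]

theorem isTernaryTo (hirr : PathIrreducible G w W x m δ) (hx : x ∉ W) (hxw : x ≠ w)
    (hr : 0 < pathDensity G w W x) (hδ : 0 < δ) (hM : 3 ^ (M + 1) * δ ≤ 1 / 1000)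
    (hm : 3 * M + D + 3 ≤ m)
    (hD : ∀ (W' : Finset V) (x' : V), x' ∉ W' → x' ≠ w →
      pathDensity G w W x / 2 ≤ pathDensity G w W' x' → (nbrsIn G W' x').card ≤ D) :
    IsTernaryTo G w W x M := by
  classical
  have hδ' : δ ≤ 1 / 1000 := by
    nlinarith [one_le_pow₀ (M₀ := ℝ) (a := 3) (n := M + 1) (by norm_num)]
  have hmain {A : List V} {a : V} (hA : IsInducedPathFrom G W x (A ++ [a])) (hAM : A.length ≤ M) :=
    hirr.ne_and_card_and_le hx hxw hr hδ hM hm hD hA hAM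
  have hdens {A : List V} {a : V} (hA : IsInducedPathFrom G W x (A ++ [a]))
      (hAM : A.length ≤ M) : 0.999 * pathDensity G w W x ≤ pathDensity G w (unseen G W A) a := by
    have hpow : (3 : ℝ) ^ A.length * δ ≤ 3 ^ (M + 1) * δ :=
      mul_le_mul_of_nonneg_right (pow_le_pow_right₀ (by norm_num) (by omega)) hδ.le
    nlinarith [(hmain hA hAM).2.2]
  have hup {A : List V} {a : V} (hA : IsInducedPathFrom G W x (A ++ [a])) (hAM : A.length ≤ M)
      {W' : Finset V} (hW' : W' ⊆ unseen G W A) (hk : (unseen G W A).card ≤ W'.card + 1) :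
      pathDensity G w W' a ≤ (1 + δ) * pathDensity G w W x :=
    hirr.pathDensity_le_of_subset_unseen (hmain hA hAM).2.1 (by omega) hW'
      (fun h ↦ hA.notMem_unseen hx a (by simp) (hW' h)) hk
  refine ⟨hx, hr, fun hA hAM ↦ (hmain hA hAM).1, fun hA hAM ↦ ?_,
    fun hA hAM ↦ (hmain hA hAM).2.1, fun hA hAM ↦ ?_, fun hA hAM ↦ ?_, fun hA hAM y hy ↦ ?_⟩
  · exact hirr.card_nbrsIn_eq_three hx hr hδ' hD hA (hmain hA hAM).2.1 (by omega)
      (hmain hA hAM).1 (hdens hA hAM)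
  · linarith [hdens hA hAM]
  · nlinarith [hup hA hAM subset_rfl (Nat.le_succ _)]
  · refine mul_card_le_countPaths_mem hy (hA.notMem_unseen hx _ (by simp)) ?_
    have := hup hA hAM (Finset.erase_subset y _) (Finset.card_erase_add_one hy).ge
    nlinarith [hdens hA hAM]

end PathIrreducible

end

/-! ### Inhomogeneous steps and chords -/

section

theorem exists_eq_append_cons_last {α : Type*} {p : α → Prop} {l : List α} (h : ∃ a ∈ l, p a) :
    ∃ P a S, l = P ++ a :: S ∧ p a ∧ ∀ c ∈ S, ¬ p c := by
  induction l with
  | nil => simp at h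
  | cons b l ih =>
    by_cases h' : ∃ a ∈ l, p a
    · obtain ⟨P, a, S, rfl, ha, hS⟩ := ih h'
      exact ⟨b :: P, a, S, rfl, ha, hS⟩
    · exact ⟨[], b, l, rfl, by grind, by grind⟩

theorem exists_eq_append_cons_first {α : Type*} {p : α → Prop} {l : List α} (h : ∃ a ∈ l, p a) :
    ∃ P a S, l = P ++ a :: S ∧ p a ∧ ∀ c ∈ P, ¬ p c := by
  obtain ⟨P, a, S, hl, ha, hS⟩ :=
    exists_eq_append_cons_last (p := p) (l := l.reverse) (by simpa using h)
  exact ⟨S.reverse, a, P.reverse, by simpa using congrArg List.reverse hl, ha, by simpa using hS⟩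

theorem exists_eq_append_cons_length {α : Type*} {l : List α} {i : ℕ} (h : i < l.length) :
    ∃ A a T, l = A ++ a :: T ∧ A.length = i :=
  ⟨l.take i, l[i], l.drop (i + 1), by simp, by simp; omega⟩

theorem exists_mem_notMem_of_card_le {α : Type*} {s t : Finset α} (hne : s ≠ t)
    (h : s.card ≤ t.card) : ∃ a ∈ t, a ∉ s :=
  Finset.not_subset.1 fun hts ↦ hne (Finset.eq_of_subset_of_card_le hts h).symm

variable {V : Type*} {G : SimpleGraph V} {W : Finset V} {x w : V}

/- The vertices before and after the last visit to `A₁` would both be in `A₂`, and the vertex two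
steps after that visit would be adjacent to `A₁` or to both of them. -/
theorem IsInducedPath.notMem_of_dead_end {A₁ A₂ : Finset V} (hw₁ : w ∉ A₁) (hw₂ : w ∉ A₂)
    (h₁ : ∀ a ∈ A₁, ∀ u ∈ W, u ∉ A₁ → (G.Adj a u ↔ u ∈ A₂))
    (h₂ : ∀ a ∈ A₂, ∀ a' ∈ A₂, ∀ u ∈ W, u ∉ A₁ → u ∉ A₂ → G.Adj a u → G.Adj a' u)
    {l : List V} (hl : IsInducedPath G l) (hlW : ∀ c ∈ l, c ∈ W)
    (hhead : ∀ y, l.head? = some y → y ∉ A₁) (hlast : l.getLast? = some w) :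
    ∀ a ∈ A₁, a ∉ l := by
  intro a₀ ha₀ hal₀
  obtain ⟨P, a, S, rfl, ha, hS⟩ := exists_eq_append_cons_last (p := (· ∈ A₁)) ⟨a₀, hal₀, ha₀⟩
  rcases P.eq_nil_or_concat' with rfl | ⟨P, p, rfl⟩
  · exact hhead a rfl ha
  rcases S with _ | ⟨s, _ | ⟨t, S⟩⟩
  · obtain rfl : a = w := by simpa using hlast
    exact hw₁ ha
  · obtain rfl : s = w := by simpa using hlast
    have has : G.Adj a s := by
      have := (isInducedPath_append.1 hl).2.1.2.1 s (by simp)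
      exact this.2 rfl
    exact hw₂ ((h₁ a ha s (hlW s (by simp)) (hS s (by simp))).1 has)
  obtain ⟨-, hfuture, hcross⟩ := isInducedPath_append.1 hl
  have hpa : G.Adj p a := (hcross p (by simp) a (by simp)).2.2 (by simp)
  have has : G.Adj a s := (hfuture.2.1 s (by simp)).2 rfl
  have hst : G.Adj s t := (hfuture.2.2.2.1 t (by simp)).2 rfl
  have hat : ¬ G.Adj a t := fun h ↦ hst.ne (by simpa using (hfuture.2.1 t (by simp)).1 h)
  have hnot : ∀ u ∈ s :: t :: S, ¬ G.Adj p u := fun u hu h ↦ by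
    have := ((hcross p (by simp) u (List.mem_cons_of_mem a hu)).2.1 h).2
    grind
  have hs : s ∈ A₂ := (h₁ a ha s (hlW s (by simp)) (hS s (by simp))).1 has
  have hp : p ∉ A₁ := fun hp ↦
    hnot s (by simp) ((h₁ p hp s (hlW s (by simp)) (hS s (by simp))).2 hs)
  have hp₂ : p ∈ A₂ := (h₁ a ha p (hlW p (by simp)) hp).1 hpa.symm
  have ht : t ∉ A₂ := fun ht ↦ hat ((h₁ a ha t (hlW t (by simp)) (hS t (by simp))).2 ht)
  exact hnot t (by simp) (h₂ s hs p hp₂ t (hlW t (by simp)) (hS t (by simp)) ht hst)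

/-- All neighbours of `x` in `W` have the same neighbours among the vertices of `W` not adjacent to
`x`: they can serve as a cluster of a braid. -/
def HomogeneousAt (G : SimpleGraph V) (W : Finset V) (x : V) : Prop :=
  ∀ v ∈ nbrsIn G W x, ∀ v' ∈ nbrsIn G W x,
    nbrsIn G (unseen G W [x]) v = nbrsIn G (unseen G W [x]) v'

theorem HomogeneousAt.adj_iff (h : HomogeneousAt G W x) {v v' u : V} (hv : v ∈ nbrsIn G W x)
    (hv' : v' ∈ nbrsIn G W x) (hu : u ∈ W) (hux : u ∉ nbrsIn G W x) :
    G.Adj v u ↔ u ∈ nbrsIn G (unseen G W [x]) v' := by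
  have hunseen : u ∈ unseen G W [x] :=
    mem_unseen_singleton.2 ⟨hu, fun hadj ↦ hux (mem_nbrsIn.2 ⟨hu, hadj⟩)⟩
  rw [← h v hv v' hv', mem_nbrsIn]
  exact (and_iff_right hunseen).symm

theorem IsInducedPath.notMem_nbrsIn_of_homogeneousAt {b e : V} (hb : HomogeneousAt G W b)
    (he : e ∈ nbrsIn G W b) (heh : HomogeneousAt G (unseen G W [b]) e)
    (hwb : w ∉ nbrsIn G W b) (hwe : w ∉ nbrsIn G (unseen G W [b]) e)
    {l : List V} (hl : IsInducedPath G l) (hlW : ∀ c ∈ l, c ∈ W)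
    (hhead : ∀ y, l.head? = some y → y ∉ nbrsIn G W b) (hlast : l.getLast? = some w) :
    ∀ z ∈ nbrsIn G W b, z ∉ l := by
  refine notMem_of_dead_end hwb hwe (fun a ha u hu hub ↦ hb.adj_iff ha he hu hub)
    (fun a ha a' ha' u hu hub hue hadj ↦ ?_) hl hlW hhead hlast
  have hunseen : u ∈ unseen G W [b] :=
    mem_unseen_singleton.2 ⟨hu, fun hbu ↦ hub (mem_nbrsIn.2 ⟨hu, hbu⟩)⟩
  exact (mem_nbrsIn.1 ((heh.adj_iff ha ha' hunseen hue).1 hadj)).2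

/-- The path `l` has a vertex at position `i`, and when it gets there, the neighbours of this vertex
among the vertices still unseen do not form a cluster. -/
def InhomogeneousStep (G : SimpleGraph V) (W : Finset V) (i : ℕ) (l : List V) : Prop :=
  ∃ A a T, l = A ++ a :: T ∧ A.length = i ∧ ¬ HomogeneousAt G (unseen G W A) a

/-- Some vertex of `W` has its first neighbour on `l` at position `i` and another one at
position `k` or later. -/
def HasChord (G : SimpleGraph V) (W : Finset V) (i k : ℕ) (l : List V) : Prop :=
  ∃ v ∈ unseen G W (l.take i), v ∈ seen G W (l.take (i + 1)) ∧ v ∈ seen G W (l.drop k)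

namespace IsTernaryTo

variable {M : ℕ} {A T l : List V} {a b e : V}

theorem exists_mem_inducedPaths_mem (hT : IsTernaryTo G w W x M)
    (hA : IsInducedPathFrom G W x (A ++ [a])) (hAM : A.length ≤ M) {y : V}
    (hy : y ∈ unseen G W A) : ∃ l ∈ inducedPaths G w (unseen G W A) a, y ∈ l := by
  have hpos : (0 : ℝ) < (inducedPaths G w (unseen G W A) a).card := by
    rw [card_inducedPaths_eq_pathDensity_mul]
    refine mul_pos (lt_of_lt_of_le ?_ (hT.le_pathDensity hA hAM)) (pow_pos cbrtThree_pos _)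
    exact mul_pos (by norm_num) hT.pos
  have hcount : (0 : ℝ) < countPaths G w (unseen G W A) a (y ∈ ·) :=
    lt_of_lt_of_le (by positivity) (hT.mul_card_le hA hAM y hy)
  exact countPaths_pos.1 (Nat.cast_pos.1 hcount)

/- If `b` and some other child `v` of `a` had different neighbours, then a path through `v` could
visit a neighbour of `b` that `v` does not see; but the neighbours of `b` are a dead end. -/
theorem homogeneousAt (hT : IsTernaryTo G w W x M) (hA : IsInducedPathFrom G W x (A ++ [a]))
    (hAM : A.length + 3 ≤ M) (hb : b ∈ nbrsIn G (unseen G W A) a)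
    (he : e ∈ nbrsIn G (unseen G W (A ++ [a])) b)
    (hbh : HomogeneousAt G (unseen G W (A ++ [a])) b)
    (heh : HomogeneousAt G (unseen G W (A ++ [a] ++ [b])) e) :
    HomogeneousAt G (unseen G W A) a := by
  have hx := hT.notMem
  have hAb := hA.snoc hx hb
  have hAe := hAb.snoc hx he
  suffices hsame : ∀ v ∈ nbrsIn G (unseen G W A) a,
      nbrsIn G (unseen G W (A ++ [a])) v = nbrsIn G (unseen G W (A ++ [a])) b by
    intro v hv v' hv'
    rw [← unseen_append, hsame v hv, hsame v' hv']
  intro v hv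
  by_contra hne
  have hAv := hA.snoc hx hv
  have hcard_v := hT.card_nbrsIn hAv (by simp; omega)
  have hcard_b := hT.card_nbrsIn hAb (by simp; omega)
  obtain ⟨y, hyv, hyb⟩ := exists_mem_notMem_of_card_le (Ne.symm hne) (by omega)
  obtain ⟨z, hzb, hzv⟩ := exists_mem_notMem_of_card_le hne (by omega)
  have hz : z ∈ unseen G W (A ++ [a] ++ [v]) := by
    rw [unseen_append, mem_unseen_singleton]
    exact ⟨(mem_nbrsIn.1 hzb).1, fun hadj ↦ hzv (mem_nbrsIn.2 ⟨(mem_nbrsIn.1 hzb).1, hadj⟩)⟩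
  obtain ⟨l, hl, hzl⟩ := hT.exists_mem_inducedPaths_mem (hAv.snoc hx hyv) (by simp; omega) hz
  obtain ⟨hlfrom, hlast⟩ := mem_inducedPaths.1 hl
  obtain ⟨T, rfl⟩ := hlfrom.exists_eq_cons
  have hwb : w ∉ nbrsIn G (unseen G W (A ++ [a])) b := fun hw ↦
    hT.ne (hAb.snoc hx hw) (by simp; omega) rfl
  have hwe : w ∉ nbrsIn G (unseen G W (A ++ [a] ++ [b])) e := fun hw ↦
    hT.ne (hAe.snoc hx hw) (by simp; omega) rfl
  rw [unseen_append (A ++ [a])] at heh hwe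
  refine hlfrom.1.notMem_nbrsIn_of_homogeneousAt hbh he heh hwb hwe (fun c hc ↦ ?_) (by simpa)
    hlast z hzb hzl
  rcases List.mem_cons.1 hc with rfl | hc
  · exact (mem_nbrsIn.1 hyv).1
  · have := hlfrom.2.2 c hc
    rw [unseen_append] at this
    exact unseen_subset _ this

theorem lt_length (hT : IsTernaryTo G w W x M) (hl : l ∈ inducedPaths G w W x) :
    M + 1 < l.length := by
  obtain ⟨hlfrom, hlast⟩ := mem_inducedPaths.1 hl
  by_contra! hshort
  obtain ⟨A, rfl⟩ := List.getLast?_eq_some_iff.1 hlast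
  exact hT.ne hlfrom (by simpa using hshort) rfl

theorem not_homogeneousAt_succ (hT : IsTernaryTo G w W x M) (hroot : ¬ HomogeneousAt G W x)
    (hl : IsInducedPathFrom G W x (A ++ a :: b :: T)) (hAM : A.length + 2 ≤ M)
    (ha : HomogeneousAt G (unseen G W A) a) : ¬ HomogeneousAt G (unseen G W (A ++ [a])) b := by
  have hx := hT.notMem
  induction A using List.reverseRecOn generalizing a b T with
  | nil =>
    obtain rfl : a = x := by simpa using hl.2.1
    exact absurd (by simpa using ha) hroot
  | append_singleton A a₀ ih =>
    intro hb
    rw [List.length_append, List.length_singleton] at hAM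
    have hl' : IsInducedPathFrom G W x (A ++ a₀ :: a :: b :: T) := by simpa using hl
    have hA : IsInducedPathFrom G W x (A ++ [a₀]) :=
      IsInducedPathFrom.of_append (B := a :: b :: T) (by simp) (by simpa using hl)
    have ha₀ := hT.homogeneousAt hA (by omega) (IsInducedPathFrom.mem_nbrsIn_of_append hx hl')
      (IsInducedPathFrom.mem_nbrsIn_of_append hx hl) ha hb
    exact ih hl' (by omega) ha₀ ha

theorem card_le_countPaths_inhomogeneousStep (hT : IsTernaryTo G w W x M)
    (hroot : ¬ HomogeneousAt G W x) {i : ℕ} (hi : i + 2 ≤ M) :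
    (inducedPaths G w W x).card ≤ countPaths G w W x (InhomogeneousStep G W i) +
      countPaths G w W x (InhomogeneousStep G W (i + 1)) := by
  refine le_trans ?_ countPaths_or_le
  rw [← countPaths_true]
  refine countPaths_mono fun l hl _ ↦ ?_
  have hlen := hT.lt_length hl
  obtain ⟨A, a, T, rfl, rfl⟩ := exists_eq_append_cons_length (l := l) (i := i) (by omega)
  by_cases ha : HomogeneousAt G (unseen G W A) a
  · obtain ⟨b, T, rfl⟩ : ∃ b T', T = b :: T' :=
      List.exists_cons_of_ne_nil fun h ↦ by simp [h] at hlen; omega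
    exact .inr ⟨A ++ [a], b, T, by simp, by simp,
      hT.not_homogeneousAt_succ hroot (mem_inducedPaths.1 hl).1 hi ha⟩
  · exact .inl ⟨A, a, T, rfl, rfl, ha⟩

theorem mul_countPaths_prefix_le (hT : IsTernaryTo G w W x M)
    (hA : IsInducedPathFrom G W x (A ++ [a])) (hAM : A.length ≤ M) {y : V}
    (hy : y ∈ unseen G W A) {p : List V → Prop}
    (hp : ∀ T, a :: T ∈ inducedPaths G w (unseen G W A) a → y ∈ T → p (A ++ a :: T)) :
    0.3 * (countPaths G w W x (A ++ [a] <+: ·) : ℝ) ≤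
      countPaths G w W x fun l ↦ A ++ [a] <+: l ∧ p l := by
  have hx := hT.notMem
  rw [countPaths_prefix hx hA, countPaths_prefix_and hx hA]
  refine (hT.mul_card_le hA hAM y hy).trans (Nat.cast_le.2 (countPaths_mono fun l hl hyl ↦ ?_))
  obtain ⟨T, rfl⟩ := exists_eq_cons_of_mem_inducedPaths hl
  have hya : y ≠ a := fun h ↦ hA.notMem_unseen hx a (by simp) (h ▸ hy)
  exact hp T hl ((List.mem_cons.1 hyl).resolve_left hya)

theorem mul_countPaths_prefix_le_hasChord (hT : IsTernaryTo G w W x M)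
    (hA : IsInducedPathFrom G W x (A ++ [a] ++ [b])) (hAM : A.length + 1 ≤ M)
    (hhom : ¬ HomogeneousAt G (unseen G W A) a) :
    0.3 * (countPaths G w W x (A ++ [a] ++ [b] <+: ·) : ℝ) ≤
      countPaths G w W x fun l ↦
        A ++ [a] ++ [b] <+: l ∧ HasChord G W A.length (A.length + 3) l := by
  have hx := hT.notMem
  have ha : IsInducedPathFrom G W x (A ++ [a]) := hA.of_append (by simp)
  obtain ⟨v, hv, hne⟩ : ∃ v ∈ nbrsIn G (unseen G W A) a,
      nbrsIn G (unseen G W (A ++ [a])) b ≠ nbrsIn G (unseen G W (A ++ [a])) v := by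
    by_contra! hsame
    refine hhom fun v hv v' hv' ↦ ?_
    rw [← unseen_append, ← hsame v hv, ← hsame v' hv']
  have hcard_v := hT.card_nbrsIn (ha.snoc hx hv) (by simpa using hAM)
  have hcard_b := hT.card_nbrsIn hA (by simpa using hAM)
  obtain ⟨y, hyv, hyb⟩ := exists_mem_notMem_of_card_le hne (by omega)
  obtain ⟨hy, hvy⟩ := mem_nbrsIn.1 hyv
  obtain ⟨hvA, hav⟩ := mem_nbrsIn.1 hv
  refine hT.mul_countPaths_prefix_le hA (by simpa using hAM) hy fun T hl hyT ↦ ?_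
  have hvW := unseen_subset _ hvA
  refine ⟨v, by simpa using hvA, mem_seen.2 ⟨hvW, a, by simp [List.take_append], hav⟩,
    mem_seen.2 ⟨hvW, y, ?_, hvy.symm⟩⟩
  have hby : ¬ G.Adj b y := fun h ↦ hyb (mem_nbrsIn.2 ⟨hy, h⟩)
  have hhead := (mem_inducedPaths.1 hl).1.1.2.1 y hyT
  obtain ⟨c, T, rfl⟩ := List.exists_cons_of_ne_nil (List.ne_nil_of_mem hyT)
  have hyT' : y ∈ T := (List.mem_cons.1 hyT).resolve_left (by grind)
  simp [List.drop_append, hyT']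

end IsTernaryTo

end

section

variable {V : Type*} {G : SimpleGraph V} {W : Finset V} {x w : V}

theorem IsInducedPath.not_adj_of_append {A Q B : List V} (h : IsInducedPath G (A ++ (Q ++ B)))
    (hQ : Q ≠ []) {a b : V} (ha : a ∈ A) (hb : b ∈ B) : ¬ G.Adj a b := by
  obtain ⟨-, hQB, hcross⟩ := isInducedPath_append.1 h
  obtain ⟨q, Q, rfl⟩ := List.exists_cons_of_ne_nil hQ
  intro hadj
  have hqb : q = b := by
    simpa using ((hcross a ha b (List.mem_append_right _ hb)).2.1 hadj).2
  exact ((isInducedPath_append.1 hQB).2.2 q (by simp) b hb).1 hqb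

/-- The vertex `v` may replace the stretch `Q` of the path `A ++ a :: (Q ++ b :: R)`, and this makes
the path shorter. -/
structure IsShortcut (G : SimpleGraph V) (A : List V) (a : V) (Q : List V) (b : V) (R : List V)
    (v : V) : Prop where
  two_le_length : 2 ≤ Q.length
  adj_left : G.Adj a v
  adj_right : G.Adj v b
  not_adj_of_mem_left : ∀ c ∈ A, ¬ G.Adj c v
  not_adj_of_mem_right : ∀ c ∈ R, ¬ G.Adj v c

namespace IsShortcut

variable {A Q R : List V} {a b v : V}

theorem ne_nil (h : IsShortcut G A a Q b R v) : Q ≠ [] :=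
  List.ne_nil_of_length_pos (by have := h.two_le_length; omega)

theorem isInducedPathFrom (h : IsShortcut G A a Q b R v) (hx : x ∉ W) (hv : v ∈ W)
    (hl : IsInducedPathFrom G W x (A ++ a :: (Q ++ b :: R))) :
    IsInducedPathFrom G W x (A ++ [a] ++ [v] ++ b :: R) := by
  obtain ⟨hpath, -, htail⟩ := id hl
  have hAa : IsInducedPathFrom G W x (A ++ [a]) :=
    IsInducedPathFrom.of_append (B := Q ++ b :: R) (by simp) (by simpa using hl)
  have hskip : ∀ d ∈ b :: R, d ∈ unseen G W (A ++ [a]) := fun d hd ↦ by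
    refine mem_unseen.2 ⟨htail d (by cases A <;> grind), fun c hc ↦ ?_⟩
    exact IsInducedPath.not_adj_of_append (Q := Q) (by simpa using hpath) h.ne_nil hc hd
  have hAv := hAa.snoc hx (mem_nbrsIn.2 ⟨mem_unseen.2 ⟨hv, h.not_adj_of_mem_left⟩, h.adj_left⟩)
  have hAb := hAv.snoc hx (mem_nbrsIn.2 ⟨hskip b (by simp), h.adj_right⟩)
  refine (hAb.append_iff hx).2 ⟨?_, rfl, fun d hd ↦ ?_⟩
  · exact ((isInducedPath_append (l₁ := A ++ a :: Q)).1 (by simpa using hpath)).2.1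
  · rw [unseen_append, mem_unseen_singleton]
    exact ⟨hskip d (List.mem_cons_of_mem b hd), h.not_adj_of_mem_right d hd⟩

/- Skipping `Q` leaves something unseen. Walking along `Q`, which starts next to `a`, one finds an
edge that leads to an unseen vertex. -/
theorem exists_adj_unseen (hl : IsInducedPathFrom G W x (A ++ a :: (Q ++ b :: R)))
    (hcard : (unseen G W (A ++ a :: (Q ++ b :: R))).card <
      (unseen G W (A ++ [a] ++ [v] ++ b :: R)).card) :
    ∃ z ∈ Q, z ∉ unseen G W (A ++ [a] ++ [v] ++ b :: R) ∧
      ∃ z' ∈ unseen G W (A ++ [a] ++ [v] ++ b :: R), G.Adj z z' := by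
  have hpath : IsInducedPath G (a :: Q) :=
    (isInducedPath_append.1 ((isInducedPath_append (l₂ := a :: Q ++ b :: R)).1 hl.1).2.1).1
  by_cases hunseen : ∃ z ∈ Q, z ∈ unseen G W (A ++ [a] ++ [v] ++ b :: R)
  · obtain ⟨P, z', S, rfl, hz', hP⟩ := exists_eq_append_cons_first hunseen
    rcases P.eq_nil_or_concat' with rfl | ⟨P, z, rfl⟩
    · exact absurd ((hpath.2.1 z' (by simp)).2 rfl) ((mem_unseen.1 hz').2 a (by simp))
    · refine ⟨z, by simp, hP z (by simp), z', hz', ?_⟩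
      exact ((isInducedPath_append.1 hpath.2.2).2.2 z (by simp) z' (by simp)).2.2 (by simp)
  · push Not at hunseen
    obtain ⟨u, hu, hu'⟩ := Finset.exists_mem_notMem_of_card_lt_card hcard
    obtain ⟨z, hzQ, hzu⟩ : ∃ z ∈ Q, G.Adj z u := by
      by_contra! hQ
      obtain ⟨huW, hnot⟩ := mem_unseen.1 hu
      exact hu' (mem_unseen.2 ⟨huW, by grind⟩)
    exact ⟨z, hzQ, hunseen z hzQ, u, hu, hzu⟩

end IsShortcut

theorem exists_hasChord_of_mem_unseen {A P S : List V} {z c : V} {k : ℕ}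
    (hzA : z ∈ unseen G W A) (hzP : z ∉ unseen G W (A ++ P)) (hc : c ∈ (A ++ P ++ S).drop k)
    (hzc : G.Adj z c) :
    ∃ j ∈ Finset.range P.length, HasChord G W (A.length + j) k (A ++ P ++ S) := by
  obtain ⟨hzW, hA⟩ := mem_unseen.1 hzA
  have hseen : ∃ p ∈ P, G.Adj p z := by
    by_contra! hP
    exact hzP (mem_unseen.2 ⟨hzW, by grind⟩)
  obtain ⟨P₁, p, P₂, rfl, hpz, hP₁⟩ := exists_eq_append_cons_first hseen
  refine ⟨P₁.length, by simp, z, mem_unseen.2 ⟨hzW, ?_⟩, mem_seen.2 ⟨hzW, p, ?_, hpz⟩,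
    mem_seen.2 ⟨hzW, c, hc, hzc.symm⟩⟩
  · have htake : (A ++ (P₁ ++ p :: P₂) ++ S).take (A.length + P₁.length) = A ++ P₁ := by
      rw [← List.length_append, ← List.append_assoc, List.append_assoc, List.take_left]
    rw [htake]
    grind
  · simp [List.take_append, Nat.add_assoc]

/-- Some vertex of `W` has its first neighbour on `l` at position `i` and its last one at
position `i + 1 + q`, where `q ≥ 2`. -/
def HasShortChord (G : SimpleGraph V) (W : Finset V) (i q : ℕ) (l : List V) : Prop :=
  ∃ A a Q b R, ∃ v ∈ W, l = A ++ a :: (Q ++ b :: R) ∧ A.length = i ∧ Q.length = q ∧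
    IsShortcut G A a Q b R v

theorem HasChord.long_or_short {i k L : ℕ} {l : List V} (h : HasChord G W i (i + 3) l)
    (hk : k ≤ i + L) : HasChord G W i k l ∨ ∃ q ∈ Finset.range L, HasShortChord G W i q l := by
  obtain ⟨v, hv, hfirst, hlater⟩ := h
  obtain ⟨hvW, c, hc, hcv⟩ := mem_seen.1 hlater
  have hil : i < l.length := by
    have := List.length_pos_of_mem hc
    rw [List.length_drop] at this
    omega
  obtain ⟨A, a, T, rfl, rfl⟩ := exists_eq_append_cons_length hil
  obtain ⟨-, hA⟩ := mem_unseen.1 hv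
  rw [List.take_left] at hA
  have hav : G.Adj a v := by
    obtain ⟨-, d, hd, hdv⟩ := mem_seen.1 hfirst
    have : d ∈ A ∨ d = a := by simpa [List.take_append, List.take_of_length_le] using hd
    grind
  have hcT : c ∈ T.drop 2 := by simpa [List.drop_append, List.drop_eq_nil_of_le] using hc
  obtain ⟨Q, b, R, rfl, hb, hR⟩ := exists_eq_append_cons_last (p := G.Adj v)
    ⟨c, List.mem_of_mem_drop hcT, hcv.symm⟩
  have hQ : 2 ≤ Q.length := by
    by_contra! hQ
    refine hR c ?_ hcv.symm
    rcases Q with _ | ⟨q, _ | ⟨q', Q⟩⟩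
    · exact List.mem_of_mem_tail (by simpa [List.drop_succ_cons] using hcT)
    · simpa using hcT
    · simp at hQ
  rcases le_or_gt k (A.length + 1 + Q.length) with hlong | hshort
  · refine .inl ⟨v, hv, hfirst, mem_seen.2 ⟨hvW, b, ?_, hb.symm⟩⟩
    have : A ++ a :: (Q ++ b :: R) = A ++ [a] ++ Q ++ b :: R := by simp
    rw [this, List.drop_append]
    have h0 : k - (A ++ [a] ++ Q).length = 0 := by simp; omega
    rw [h0]
    simp
  · exact .inr ⟨Q.length, by simp; omega, A, a, Q, b, R, v, hvW, rfl, rfl, rfl, hQ, hav, hb, hA, hR⟩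

open scoped Classical in
theorem card_hasChord_le {s N k : ℕ} (h : s + N ≤ k) (l : List V) :
    {i ∈ Finset.range N | HasChord G W (s + i) k l}.card ≤ straddleCount G W k l := by
  refine Finset.card_le_card_of_forall_subsingleton
    (fun i v ↦ v ∈ unseen G W (l.take (s + i)) ∧ v ∈ seen G W (l.take (s + i + 1)))
    (fun i hi ↦ ?_) fun v _ i hi j hj ↦ ?_
  · obtain ⟨hiN, v, hfresh, hfirst, hlast⟩ := Finset.mem_filter.1 hi
    obtain ⟨hvW, c, hc, hcv⟩ := mem_seen.1 hfirst
    have hck : c ∈ l.take k :=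
      List.take_subset_take_left l (by rw [Finset.mem_range] at hiN; omega) hc
    exact ⟨v, Finset.mem_inter.2 ⟨mem_seen.2 ⟨hvW, c, hck, hcv⟩, hlast⟩, hfresh, hfirst⟩
  · wlog hlt : i < j generalizing i j
    · rcases eq_or_ne i j with rfl | hne
      · rfl
      · exact (this j hj i hi (by omega)).symm
    obtain ⟨-, c, hc, hcv⟩ := mem_seen.1 hi.2.2
    have hcj : c ∈ l.take (s + j) := List.take_subset_take_left l (by omega) hc
    exact absurd hcv ((mem_unseen.1 hj.2.1).2 c hcj)

theorem sum_countPaths_hasChord_le {s N k : ℕ} (hx : x ∉ W) (hxw : x ≠ w) (h : s + N ≤ k) :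
    ∑ i ∈ Finset.range N, (countPaths G w W x (HasChord G W (s + i) k) : ℝ) ≤
      138 * cbrtThree ^ W.card := by
  classical
  refine le_trans ?_ (sum_straddleCount_le (G := G) hx hxw k)
  simp only [countPaths_eq_card_filter]
  exact_mod_cast (Finset.sum_card_bipartiteAbove_eq_sum_card_bipartiteBelow
    (s := Finset.range N) (t := inducedPaths G w W x)
    fun i l ↦ HasChord G W (s + i) k l).trans_le
    (Finset.sum_le_sum fun l _ ↦ card_hasChord_le h l)

end

section

variable {V : Type*} {G : SimpleGraph V} {W : Finset V} {x w : V}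

namespace IsTernaryTo

variable {M : ℕ} {A B l : List V}

theorem mul_countPaths_inhomogeneousStep_le (hT : IsTernaryTo G w W x M) {i : ℕ}
    (hi : i + 1 ≤ M) : 0.3 * (countPaths G w W x (InhomogeneousStep G W i) : ℝ) ≤
      countPaths G w W x (HasChord G W i (i + 3)) := by
  set t := initialSegments G w W x (InhomogeneousStep G W i) (i + 2)
  have hseg : ∀ σ ∈ t, σ.length = i + 2 ∧ 0.3 * (countPaths G w W x (σ <+: ·) : ℝ) ≤
      countPaths G w W x fun l ↦ σ <+: l ∧ HasChord G W i (i + 3) l := fun σ hσ ↦ by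
    obtain ⟨l, hl, ⟨A, a, T, rfl, rfl, hhom⟩, rfl⟩ := mem_initialSegments.1 hσ
    have hlen := hT.lt_length hl
    obtain ⟨b, T, rfl⟩ : ∃ b T', T = b :: T' :=
      List.exists_cons_of_ne_nil fun h ↦ by simp [h] at hlen; omega
    have hl' : A ++ a :: b :: T = A ++ [a] ++ [b] ++ T := by simp
    have htake : (A ++ a :: b :: T).take (A.length + 2) = A ++ [a] ++ [b] := by
      rw [hl']
      exact List.take_left' (by simp)
    rw [htake]
    refine ⟨by simp, hT.mul_countPaths_prefix_le_hasChord ?_ hi hhom⟩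
    exact IsInducedPathFrom.of_append (B := T) (by simp) (hl' ▸ (mem_inducedPaths.1 hl).1)
  calc 0.3 * (countPaths G w W x (InhomogeneousStep G W i) : ℝ)
      ≤ 0.3 * ∑ σ ∈ t, (countPaths G w W x (σ <+: ·) : ℝ) := by
        refine mul_le_mul_of_nonneg_left ?_ (by norm_num)
        exact_mod_cast countPaths_le_sum_initialSegments (i + 2)
    _ ≤ ∑ σ ∈ t, (countPaths G w W x (fun l ↦ σ <+: l ∧ HasChord G W i (i + 3) l) : ℝ) := by
        rw [Finset.mul_sum]
        exact Finset.sum_le_sum fun σ hσ ↦ (hseg σ hσ).2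
    _ ≤ countPaths G w W x (HasChord G W i (i + 3)) := by
        exact_mod_cast sum_countPaths_prefix_and_le fun σ hσ ↦ (hseg σ hσ).1

theorem mul_card_le_sum_hasChord (hT : IsTernaryTo G w W x M) (hroot : ¬ HomogeneousAt G W x)
    {s H : ℕ} (h : s + 2 * H + 1 ≤ M) :
    0.3 * H * ((inducedPaths G w W x).card : ℝ) ≤
      ∑ j ∈ Finset.range (2 * H), (countPaths G w W x (HasChord G W (s + j) (s + j + 3)) : ℝ) := by
  induction H with
  | zero => simp
  | succ H ih =>
    have hstep : ((inducedPaths G w W x).card : ℝ) ≤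
        countPaths G w W x (InhomogeneousStep G W (s + 2 * H)) +
          countPaths G w W x (InhomogeneousStep G W (s + 2 * H + 1)) := by
      exact_mod_cast hT.card_le_countPaths_inhomogeneousStep hroot (by omega)
    have h₀ := hT.mul_countPaths_inhomogeneousStep_le (i := s + 2 * H) (by omega)
    have h₁ := hT.mul_countPaths_inhomogeneousStep_le (i := s + 2 * H + 1) (by omega)
    rw [mul_add_one, Finset.sum_range_succ, Finset.sum_range_succ, ← add_assoc s]
    push_cast
    linarith [ih (by omega)]

theorem card_unseen_add_length (hT : IsTernaryTo G w W x M) (hA : IsInducedPathFrom G W x A)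
    (hAM : A.length ≤ M + 1) : (unseen G W A).card + 3 * A.length = W.card := by
  rcases A.eq_nil_or_concat' with rfl | ⟨A, a, rfl⟩
  · simp
  rw [List.length_append, List.length_singleton] at hAM ⊢
  have hcard := hT.card_unseen hA (by omega)
  have hnbrs := hT.card_nbrsIn hA (by omega)
  have hstep := card_unseen_add_card_nbrsIn (G := G) (W := unseen G W A) (x := a)
  rw [unseen_append]
  omega

theorem countPaths_prefix_le (hT : IsTernaryTo G w W x M) (hA : IsInducedPathFrom G W x A)
    (hB : IsInducedPathFrom G W x B) (hBA : B.length ≤ A.length) (hAM : A.length ≤ M + 1) :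
    (countPaths G w W x (A <+: ·) : ℝ) ≤ 1.1 * countPaths G w W x (B <+: ·) := by
  rcases B.eq_nil_or_concat' with rfl | ⟨B, b, rfl⟩
  · simp [IsInducedPathFrom] at hB
  rcases A.eq_nil_or_concat' with rfl | ⟨A, a, rfl⟩
  · simp at hBA
  simp only [List.length_append, List.length_singleton] at hBA hAM
  have hcardA := hT.card_unseen hA (by omega)
  have hcardB := hT.card_unseen hB (by omega)
  have hpow : cbrtThree ^ (unseen G W A).card ≤ cbrtThree ^ (unseen G W B).card :=
    pow_le_pow_right₀ one_lt_cbrtThree.le (by omega)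
  rw [countPaths_prefix hT.notMem hA, countPaths_prefix hT.notMem hB,
    card_inducedPaths_eq_pathDensity_mul, card_inducedPaths_eq_pathDensity_mul, ← mul_assoc]
  refine mul_le_mul ?_ hpow (pow_nonneg cbrtThree_pos.le _)
    (mul_nonneg (by norm_num) pathDensity_nonneg)
  linarith [hT.pathDensity_le hA (by omega), hT.le_pathDensity hB (by omega), hT.pos]

theorem card_le_three_of_dropLast_eq (hT : IsTernaryTo G w W x M) {a : V}
    (hAM : A.length ≤ M) {t : Finset (List V)}
    (ht : ∀ P ∈ t, P.dropLast = A ++ [a] ∧ IsInducedPathFrom G W x P) : t.card ≤ 3 := by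
  classical
  rcases t.eq_empty_or_nonempty with rfl | ⟨P₀, hP₀⟩
  · simp
  have hsnoc : ∀ P ∈ t, ∃ b, P = A ++ [a] ++ [b] := fun P hP ↦ by
    obtain ⟨B, b, rfl⟩ := P.eq_nil_or_concat'.resolve_left fun h ↦ by
      simpa [h] using (ht P hP).1
    exact ⟨b, by rw [← (ht _ hP).1, List.dropLast_concat]⟩
  have hA : IsInducedPathFrom G W x (A ++ [a]) := by
    obtain ⟨b, rfl⟩ := hsnoc P₀ hP₀
    exact (ht _ hP₀).2.of_append (by simp)
  rw [← hT.card_nbrsIn hA hAM]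
  refine (Finset.card_le_card fun P hP ↦ ?_).trans
    (Finset.card_image_le (f := fun b ↦ A ++ [a] ++ [b]))
  obtain ⟨b, rfl⟩ := hsnoc P hP
  exact Finset.mem_image.2 ⟨b, IsInducedPathFrom.mem_nbrsIn_of_append hT.notMem (T := [])
    (by simpa using (ht _ hP).2), rfl⟩

theorem card_extensions_le (hT : IsTernaryTo G w W x M) (hA : A ≠ []) {q : ℕ}
    (hq : A.length + q ≤ M + 2) {t : Finset (List V)}
    (ht : ∀ P ∈ t, A <+: P ∧ P.length = A.length + q ∧ IsInducedPathFrom G W x P) :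
    t.card ≤ 3 ^ q := by
  classical
  induction q generalizing t with
  | zero =>
    refine Finset.card_le_one_iff_subset_singleton.2 ⟨A, fun P hP ↦ Finset.mem_singleton.2 ?_⟩
    exact ((ht P hP).1.eq_of_length (ht P hP).2.1.symm).symm
  | succ q ih =>
    have hinit : ∀ P' ∈ t.image List.dropLast,
        A <+: P' ∧ P'.length = A.length + q ∧ IsInducedPathFrom G W x P' := fun P' hP' ↦ by
      obtain ⟨P, hP, rfl⟩ := Finset.mem_image.1 hP'
      obtain ⟨⟨S, rfl⟩, hlen, hfrom⟩ := ht P hP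
      obtain ⟨S, c, rfl⟩ := S.eq_nil_or_concat'.resolve_left (by rintro rfl; simp at hlen)
      rw [← List.append_assoc] at hlen hfrom ⊢
      rw [List.dropLast_concat]
      exact ⟨List.prefix_append A S, by simpa [← add_assoc] using hlen,
        hfrom.of_append (by simp [hA])⟩
    refine (Finset.card_le_mul_card_image (f := List.dropLast) t 3 fun P' hP' ↦ ?_).trans ?_
    · obtain ⟨-, hlen, hfrom⟩ := hinit P' hP'
      obtain ⟨B, b, rfl⟩ := P'.eq_nil_or_concat'.resolve_left fun h ↦ by
        simp [h, IsInducedPathFrom] at hfrom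
      rw [List.length_append, List.length_singleton] at hlen
      exact hT.card_le_three_of_dropLast_eq (A := B) (a := b) (by omega) fun P hP ↦
        ⟨(Finset.mem_filter.1 hP).2, (ht P (Finset.mem_filter.1 hP).1).2.2⟩
    · rw [pow_succ']
      exact Nat.mul_le_mul_left 3 (ih (by omega) hinit)

end IsTernaryTo

end

section

variable {V : Type*} {G : SimpleGraph V} {W : Finset V} {x w : V}

theorem IsShortcut.mono_right {A Q R R' : List V} {a b v : V} (h : IsShortcut G A a Q b R v)
    (hR : R' ⊆ R) : IsShortcut G A a Q b R' v :=
  { h with not_adj_of_mem_right := fun c hc ↦ h.not_adj_of_mem_right c (hR hc) }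

/- A vertex of `Q` is seen by the shortened path no later than by the vertex `b`, so an edge from it
to an unseen vertex `y` becomes a chord whenever the shortened path is continued through `y`. -/
theorem IsShortcut.hasChord {A Q R T : List V} {a b v y z : V} {k : ℕ}
    (hl : IsInducedPathFrom G W x (A ++ a :: (Q ++ b :: R))) (hz : z ∈ Q)
    (hzseen : z ∉ unseen G W (A ++ [a] ++ [v] ++ b :: R)) (hy : y ∈ T) (hzy : G.Adj z y)
    (hk : k ≤ (A ++ [a] ++ [v] ++ b :: R).length) :
    ∃ j ∈ Finset.range 3, HasChord G W (A.length + j) k (A ++ [a] ++ [v] ++ b :: R ++ T) := by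
  obtain ⟨hpath, -, htail⟩ := hl
  have hzW : z ∈ W := htail z (by cases A <;> simp [hz])
  have hzA : ∀ c ∈ A, ¬ G.Adj c z := fun c hc ↦
    IsInducedPath.not_adj_of_append (Q := [a]) (by simpa using hpath) (by simp) hc (by simp [hz])
  have hzR : ∀ c ∈ R, ¬ G.Adj z c := fun c hc ↦
    IsInducedPath.not_adj_of_append (A := A ++ a :: Q) (Q := [b]) (by simpa using hpath) (by simp)
      (by simp [hz]) hc
  have heq : A ++ [a] ++ [v] ++ b :: R ++ T = A ++ [a, v, b] ++ (R ++ T) := by simp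
  have hyk : y ∈ (A ++ [a, v, b] ++ (R ++ T)).drop k := by
    rw [← heq, List.drop_append_of_le_length hk]
    exact List.mem_append_right _ hy
  rw [heq]
  refine exists_hasChord_of_mem_unseen (mem_unseen.2 ⟨hzW, hzA⟩) (fun hunseen ↦ hzseen ?_) hyk hzy
  refine mem_unseen.2 ⟨hzW, fun c hc ↦ ?_⟩
  by_cases hcR : c ∈ R
  · exact fun hcz ↦ hzR c hcR hcz.symm
  · exact (mem_unseen.1 hunseen).2 c (by grind)

namespace IsTernaryTo

variable {M : ℕ}

theorem countPaths_prefix_le_of_isShortcut (hT : IsTernaryTo G w W x M) {A Q R : List V}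
    {a b v : V} {k : ℕ} (h : IsShortcut G A a Q b R v) (hv : v ∈ W)
    (hl : IsInducedPathFrom G W x (A ++ a :: (Q ++ b :: R)))
    (hlen : (A ++ a :: (Q ++ b :: R)).length = M + 1) (hk : k + Q.length ≤ M + 2) :
    countPaths G w W x (A ++ a :: (Q ++ b :: R) <+: ·) ≤
      4 * countPaths G w W x fun l ↦ A ++ [a] ++ [v] ++ b :: R <+: l ∧
        ∃ j ∈ Finset.range 3, HasChord G W (A.length + j) k l := by
  have hshort := h.isInducedPathFrom hT.notMem hv hl
  have hQ := h.two_le_length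
  have hlen' : (A ++ [a] ++ [v] ++ b :: R).length + Q.length = M + 2 := by
    simp only [List.length_append, List.length_cons, List.length_nil] at hlen ⊢
    omega
  have hcard := hT.card_unseen_add_length hl hlen.le
  have hcard' := hT.card_unseen_add_length hshort (by omega)
  obtain ⟨z, hz, hzseen, y, hy, hzy⟩ := IsShortcut.exists_adj_unseen (v := v) hl (by omega)
  have hle := hT.countPaths_prefix_le hl hshort (by omega) hlen.le
  suffices 0.3 * (countPaths G w W x (A ++ [a] ++ [v] ++ b :: R <+: ·) : ℝ) ≤
      countPaths G w W x fun l ↦ A ++ [a] ++ [v] ++ b :: R <+: l ∧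
        ∃ j ∈ Finset.range 3, HasChord G W (A.length + j) k l by
    rw [← Nat.cast_le (α := ℝ)]
    push_cast
    linarith
  have hchord := fun T ↦ IsShortcut.hasChord (T := T) (k := k) hl hz hzseen (hzy := hzy)
  obtain ⟨B, c, hB⟩ := (A ++ [a] ++ [v] ++ b :: R).eq_nil_or_concat'.resolve_left (by simp)
  rw [hB] at hshort hy hlen' hchord ⊢
  rw [List.length_append, List.length_singleton] at hlen'
  rw [unseen_append] at hy
  refine hT.mul_countPaths_prefix_le hshort (by omega) (unseen_subset _ hy) fun T _ hyT ↦ ?_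
  simpa using hchord T hyT (by simp; omega)

theorem exists_shortening (hT : IsTernaryTo G w W x M) {i q k : ℕ} (hi : i + q + 2 ≤ M + 1)
    (hk : k + q ≤ M + 2) {l : List V} (hl : l ∈ inducedPaths G w W x)
    (hlq : HasShortChord G W i q l) :
    ∃ B, B.length + q = M + 2 ∧ B.take (i + 1) = l.take (i + 1) ∧
      B.drop (i + 2) = (l.take (M + 1)).drop (i + 1 + q) ∧
      countPaths G w W x (l.take (M + 1) <+: ·) ≤ 4 * countPaths G w W x fun l ↦
        B <+: l ∧ ∃ j ∈ Finset.range 3, HasChord G W (i + j) k l := by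
  obtain ⟨A, a, Q, b, R, v, hv, rfl, rfl, rfl, h⟩ := hlq
  have hlen := hT.lt_length hl
  simp only [List.length_append, List.length_cons] at hlen
  obtain ⟨n, rfl⟩ : ∃ n, M = A.length + Q.length + 1 + n :=
    ⟨M - (A.length + Q.length + 1), by omega⟩
  have htake : (A ++ a :: (Q ++ b :: R)).take (A.length + Q.length + 1 + n + 1) =
      A ++ a :: (Q ++ b :: R.take n) := by
    have := List.take_length_add_append (l₁ := A ++ a :: (Q ++ [b])) (l₂ := R) n
    simp only [List.length_append, List.length_cons, List.length_nil, List.append_assoc,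
      List.cons_append, List.nil_append] at this
    rw [← this]
    congr 1
    omega
  have hlσ : IsInducedPathFrom G W x (A ++ a :: (Q ++ b :: R.take n)) := by
    rw [← htake]
    exact (mem_inducedPaths.1 hl).1.take (Nat.succ_ne_zero _)
  rw [htake]
  refine ⟨A ++ [a] ++ [v] ++ b :: R.take n, ?_, ?_, ?_, ?_⟩
  · simp; omega
  · rw [List.append_assoc A, List.append_assoc, List.take_length_add_append,
      List.take_length_add_append]
    simp
  · have hsplit : A ++ a :: (Q ++ b :: R.take n) = A ++ a :: Q ++ b :: R.take n := by simp
    rw [hsplit, List.drop_left' (by simp), List.drop_left' (by simp; omega)]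
  · refine hT.countPaths_prefix_le_of_isShortcut (h.mono_right (List.take_subset n R)) hv hlσ ?_ hk
    simp; omega

theorem card_le_pow_of_drop_eq (hT : IsTernaryTo G w W x M) {q : ℕ} {P S : List V} (hP : P ≠ [])
    (hPM : P.length + q ≤ M + 2) {t : Finset (List V)}
    (ht : ∀ σ ∈ t, IsInducedPathFrom G W x σ ∧ P <+: σ ∧ P.length + q ≤ σ.length ∧
      σ.drop (P.length + q) = S) : t.card ≤ 3 ^ q := by
  classical
  have hinj : Set.InjOn (List.take (P.length + q)) (t : Set (List V)) := fun σ hσ σ' hσ' heq ↦ by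
    rw [← List.take_append_drop (P.length + q) σ, ← List.take_append_drop (P.length + q) σ', heq,
      (ht σ hσ).2.2.2, (ht σ' hσ').2.2.2]
  rw [← Finset.card_image_of_injOn hinj]
  refine hT.card_extensions_le hP hPM fun P' hP' ↦ ?_
  obtain ⟨σ, hσ, rfl⟩ := Finset.mem_image.1 hP'
  obtain ⟨hfrom, hpre, hlen, -⟩ := ht σ hσ
  have := List.length_pos_of_ne_nil hP
  exact ⟨List.prefix_take_iff.2 ⟨hpre, Nat.le_add_right _ _⟩, by simpa using hlen,
    hfrom.take (by omega)⟩

theorem countPaths_hasShortChord_le (hT : IsTernaryTo G w W x M) {i q k : ℕ}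
    (hi : i + q + 2 ≤ M + 1) (hk : k + q ≤ M + 2) :
    countPaths G w W x (HasShortChord G W i q) ≤ 4 * (3 ^ q *
      countPaths G w W x fun l ↦ ∃ j ∈ Finset.range 3, HasChord G W (i + j) k l) := by
  classical
  set t := initialSegments G w W x (HasShortChord G W i q) (M + 1)
  have hseg : ∀ σ ∈ t, ∃ B, B.length + q = M + 2 ∧ B.take (i + 1) = σ.take (i + 1) ∧
      B.drop (i + 2) = σ.drop (i + 1 + q) ∧ σ.length = M + 1 ∧ IsInducedPathFrom G W x σ ∧
      countPaths G w W x (σ <+: ·) ≤ 4 * countPaths G w W x fun l ↦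
        B <+: l ∧ ∃ j ∈ Finset.range 3, HasChord G W (i + j) k l := fun σ hσ ↦ by
    obtain ⟨l, hl, hlq, rfl⟩ := mem_initialSegments.1 hσ
    have hlen := hT.lt_length hl
    obtain ⟨B, hB, htake, hdrop, hle⟩ := hT.exists_shortening hi hk hl hlq
    refine ⟨B, hB, ?_, hdrop, by simp; omega,
      (mem_inducedPaths.1 hl).1.take (Nat.succ_ne_zero _), hle⟩
    rw [htake, List.take_take, min_eq_left (by omega)]
  choose! B hB htake hdrop hlen hfrom hle using hseg
  have hfibre : ∀ l ∈ inducedPaths G w W x, {σ ∈ t | B σ <+: l}.card ≤ 3 ^ q := fun l hl ↦ by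
    have hll := hT.lt_length hl
    refine hT.card_le_pow_of_drop_eq (P := l.take (i + 1)) (S := (l.take (M + 2 - q)).drop (i + 2))
      (List.ne_nil_of_length_pos (by simp; omega)) (by simp; omega) fun σ hσ ↦ ?_
    obtain ⟨hσ, hpre⟩ := Finset.mem_filter.1 hσ
    have hBl : B σ = l.take (M + 2 - q) := by
      rw [List.prefix_iff_eq_take.1 hpre, show (B σ).length = M + 2 - q by grind]
    have hi' : (l.take (i + 1)).length = i + 1 := by simp; omega
    rw [hi', ← hdrop σ hσ, hBl, hlen σ hσ]
    refine ⟨hfrom σ hσ, ?_, by omega, rfl⟩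
    rw [← Nat.min_eq_left (show i + 1 ≤ M + 2 - q by omega), ← List.take_take, ← hBl, htake σ hσ]
    exact List.take_prefix _ _
  calc countPaths G w W x (HasShortChord G W i q)
      ≤ ∑ σ ∈ t, countPaths G w W x (σ <+: ·) := countPaths_le_sum_initialSegments (M + 1)
    _ ≤ 4 * ∑ σ ∈ t, countPaths G w W x fun l ↦
          B σ <+: l ∧ ∃ j ∈ Finset.range 3, HasChord G W (i + j) k l := by
        rw [Finset.mul_sum]
        exact Finset.sum_le_sum hle
    _ ≤ _ := Nat.mul_le_mul_left 4 (sum_countPaths_and_le fun l hl _ ↦ hfibre l hl)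

end IsTernaryTo

end

section

variable {V : Type*} {G : SimpleGraph V} {W : Finset V} {x w : V}

namespace IsTernaryTo

variable {M : ℕ}

theorem countPaths_hasChord_le (hT : IsTernaryTo G w W x M) {i k k' L : ℕ} (hk' : k' ≤ i + L)
    (hi : i + L ≤ M) (hk : k + L ≤ M + 2) :
    countPaths G w W x (HasChord G W i (i + 3)) ≤ countPaths G w W x (HasChord G W i k') +
      L * (4 * 3 ^ L) * ∑ j ∈ Finset.range 3, countPaths G w W x (HasChord G W (i + j) k) := by
  have hshort : countPaths G w W x (fun l ↦ ∃ q ∈ Finset.range L, HasShortChord G W i q l) ≤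
      L * (4 * 3 ^ L) *
        ∑ j ∈ Finset.range 3, countPaths G w W x (HasChord G W (i + j) k) := calc
    _ ≤ ∑ q ∈ Finset.range L, countPaths G w W x (HasShortChord G W i q) :=
        countPaths_exists_mem_le _ _
    _ ≤ ∑ q ∈ Finset.range L, 4 * (3 ^ L *
          ∑ j ∈ Finset.range 3, countPaths G w W x (HasChord G W (i + j) k)) := by
        refine Finset.sum_le_sum fun q hq ↦ ?_
        rw [Finset.mem_range] at hq
        refine (hT.countPaths_hasShortChord_le (k := k) (by omega) (by omega)).trans ?_
        gcongr
        · norm_num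
        · exact countPaths_exists_mem_le _ _
    _ = _ := by
        rw [Finset.sum_const, Finset.card_range, smul_eq_mul]
        ring
  refine (countPaths_mono fun l _ h ↦ h.long_or_short hk').trans ?_
  exact countPaths_or_le.trans (Nat.add_le_add_left hshort _)

/- In every block of `2 * H` consecutive positions the inhomogeneous steps produce many chords, of
which only few are long. -/
theorem mul_sub_le_sum_hasChord (hT : IsTernaryTo G w W x M) (hxw : x ≠ w)
    (hroot : ¬ HomogeneousAt G W x) {s H k : ℕ} (hs : s + 2 * (2 * H) ≤ M)
    (hk : k + 2 * H ≤ M + 2) (hM : s + 2 * H + 1 ≤ M) :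
    0.3 * H * ((inducedPaths G w W x).card : ℝ) - 138 * cbrtThree ^ W.card ≤
      (2 * H * (4 * 3 ^ (2 * H)) : ℕ) * ∑ i ∈ Finset.range (2 * H), ∑ j ∈ Finset.range 3,
        (countPaths G w W x (HasChord G W (s + i + j) k) : ℝ) := by
  have hlong := sum_countPaths_hasChord_le (G := G) (s := s) (N := 2 * H) hT.notMem hxw le_rfl
  have hmany := hT.mul_card_le_sum_hasChord hroot hM
  rw [sub_le_iff_le_add', Finset.mul_sum]
  refine hmany.trans (le_trans ?_ (add_le_add_left hlong _))
  rw [← Finset.sum_add_distrib]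
  refine Finset.sum_le_sum fun i hi ↦ ?_
  rw [Finset.mem_range] at hi
  exact_mod_cast hT.countPaths_hasChord_le (k := k) (L := 2 * H) (by omega) (by omega) hk

theorem nsmul_sub_le_of_not_homogeneousAt {H N : ℕ}
    (hT : IsTernaryTo G w W x (2 * H * N + 4 * H + 1)) (hxw : x ≠ w)
    (hroot : ¬ HomogeneousAt G W x) :
    N * (0.3 * H * ((inducedPaths G w W x).card : ℝ) - 138 * cbrtThree ^ W.card) ≤
      (2 * H * (4 * 3 ^ (2 * H)) : ℕ) * (3 * (138 * cbrtThree ^ W.card)) := by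
  set E := 2 * H * (4 * 3 ^ (2 * H))
  set k := 2 * H * N + 2
  have hblocks : ∀ n ≤ N,
      n * (0.3 * H * ((inducedPaths G w W x).card : ℝ) - 138 * cbrtThree ^ W.card) ≤
        E * ∑ i ∈ Finset.range (2 * H * n), ∑ j ∈ Finset.range 3,
          (countPaths G w W x (HasChord G W (i + j) k) : ℝ) := fun n hn ↦ by
    induction n with
    | zero => simp
    | succ n ih =>
      have hle : 2 * H * n + 2 * H ≤ 2 * H * N := by
        rw [← Nat.mul_succ]
        exact Nat.mul_le_mul_left _ hn
      have := hT.mul_sub_le_sum_hasChord (s := 2 * H * n) (H := H) (k := k) hxw hroot (by omega)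
        (by omega) (by omega)
      rw [Nat.mul_succ, Finset.sum_range_add, mul_add]
      push_cast
      linarith [ih (by omega)]
  refine (hblocks N le_rfl).trans (mul_le_mul_of_nonneg_left ?_ (Nat.cast_nonneg E))
  rw [Finset.sum_comm]
  have hcard : (3 : ℝ) = (Finset.range 3).card := by simp
  rw [hcard, ← nsmul_eq_mul]
  refine Finset.sum_le_card_nsmul _ _ _ fun j hj ↦ ?_
  simp only [add_comm _ j]
  rw [Finset.mem_range] at hj
  exact sum_countPaths_hasChord_le hT.notMem hxw (by omega)

theorem exists_homogeneousAt {ρ : ℝ} (hρ : 0 < ρ) :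
    ∃ M : ℕ, ∀ {V : Type*} (G : SimpleGraph V) (w : V) (W : Finset V) (x : V), x ≠ w →
      ρ ≤ pathDensity G w W x → IsTernaryTo G w W x M → HomogeneousAt G W x := by
  obtain ⟨H, hH⟩ := exists_nat_gt (139 / (0.3 * ρ))
  obtain ⟨N, hN⟩ := exists_nat_gt (((2 * H * (4 * 3 ^ (2 * H)) : ℕ) : ℝ) * (3 * 138))
  refine ⟨2 * H * N + 4 * H + 1, fun G w W x hxw hdens hT ↦ ?_⟩
  by_contra hroot
  have hle := hT.nsmul_sub_le_of_not_homogeneousAt hxw hroot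
  have hc : 0 < cbrtThree ^ W.card := pow_pos cbrtThree_pos _
  have hgain : cbrtThree ^ W.card ≤
      0.3 * H * ((inducedPaths G w W x).card : ℝ) - 138 * cbrtThree ^ W.card := by
    rw [div_lt_iff₀ (by positivity)] at hH
    rw [card_inducedPaths_eq_pathDensity_mul]
    have : 139 ≤ 0.3 * H * pathDensity G w W x := by nlinarith
    nlinarith
  nlinarith [mul_le_mul_of_nonneg_left hgain (Nat.cast_nonneg (α := ℝ) N)]

end IsTernaryTo

end

/-! ### Chains of clusters -/

section

theorem PathIrreducible.exists_homogeneousAt {ρ : ℝ} (hρ : 0 < ρ) :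
    ∃ (m : ℕ) (δ : ℝ), 0 < δ ∧ ∀ {V : Type*} {G : SimpleGraph V} {w : V} {W : Finset V} {x : V},
      x ∉ W → x ≠ w → ρ ≤ pathDensity G w W x → PathIrreducible G w W x m δ →
        (nbrsIn G W x).card = 3 ∧ HomogeneousAt G W x := by
  obtain ⟨M, hM⟩ := IsTernaryTo.exists_homogeneousAt hρ
  obtain ⟨D, hD⟩ := exists_card_nbrsIn_le (half_pos hρ)
  refine ⟨3 * M + D + 3, 1 / 1000 / 3 ^ (M + 1), by positivity, fun {V G w W x} hx hxw hr hirr ↦ ?_⟩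
  have hT : IsTernaryTo G w W x M :=
    hirr.isTernaryTo hx hxw (hρ.trans_le hr) (by positivity)
      (mul_div_cancel₀ _ (by positivity)).le le_rfl
      fun W' x' hx' hx'w h ↦ hD G w W' x' hx' hx'w (by linarith)
  refine ⟨?_, hM G w W x hxw hr hT⟩
  have := hT.card_nbrsIn (A := []) isInducedPathFrom_singleton (Nat.zero_le _)
  rwa [unseen_nil] at this

open scoped Classical in
/-- Outside `S`, the list `L` of three-element clusters exhausts `W`; consecutive clusters are
completely joined, no other two clusters are joined, and the vertices of `Q` are joined to the
first cluster only. -/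
def IsClusterChain {V : Type*} (G : SimpleGraph V) (S : Finset V) :
    Finset V → Finset V → List (Finset V) → Prop
  | W, _, [] => W ⊆ S
  | W, Q, B :: L => B ⊆ W ∧ B.card = 3 ∧
      (∀ a ∈ Q, a ∉ S → ∀ b ∈ W, b ∉ S → (G.Adj a b ↔ b ∈ B)) ∧ IsClusterChain G S (W \ B) B L

theorem exists_card_le_of_le_pathDensity_self {ρ : ℝ} (hρ : 0 < ρ) :
    ∃ c : ℕ, ∀ {V : Type*} {G : SimpleGraph V} {w : V} {W : Finset V},
      w ∉ W → ρ ≤ pathDensity G w W w → W.card ≤ c := by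
  obtain ⟨c, hc⟩ := pow_unbounded_of_one_lt (1 / ρ) one_lt_cbrtThree
  refine ⟨c, fun {V G w W} hw hr ↦ ?_⟩
  rw [pathDensity, inducedPaths_self hw, Finset.card_singleton, Nat.cast_one,
    le_one_div hρ (pow_pos cbrtThree_pos _)] at hr
  exact ((pow_lt_pow_iff_right₀ one_lt_cbrtThree).1 (hr.trans_lt hc)).le

variable {V : Type*} {G : SimpleGraph V} {W : Finset V} {x w : V}

namespace IsClusterChain

variable {S Q : Finset V} {L : List (Finset V)}

theorem mono {S' W' : Finset V} (h : IsClusterChain G S W Q L) (hS : S ⊆ S') (hW : W ⊆ W')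
    (hWS : ∀ v ∈ W', v ∉ S' → v ∈ W) : IsClusterChain G S' W' Q L := by
  classical
  induction L generalizing W W' Q with
  | nil =>
    intro v hv
    by_contra hvS
    exact hvS (hS (h (hWS v hv hvS)))
  | cons B L ih =>
    obtain ⟨hBW, hB, hadj, htail⟩ := h
    refine ⟨hBW.trans hW, hB, fun a ha haS b hb hbS ↦ hadj a ha (fun h ↦ haS (hS h)) b
      (hWS b hb hbS) fun h ↦ hbS (hS h),
      ih htail (Finset.sdiff_subset_sdiff hW subset_rfl) fun v hv hvS ↦ ?_⟩
    rw [Finset.mem_sdiff] at hv ⊢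
    exact ⟨hWS v hv.1 hvS, hv.2⟩

theorem cons_of_homogeneousAt {v : V} (hhom : HomogeneousAt G W x)
    (hcard : (nbrsIn G W x).card = 3) (hv : v ∈ nbrsIn G W x) (hS : S ⊆ unseen G W [x])
    (h : IsClusterChain G S (unseen G W [x]) {v} L) :
    IsClusterChain G S W {x} (nbrsIn G W x :: L) := by
  classical
  refine ⟨fun u hu ↦ (mem_nbrsIn.1 hu).1, hcard, fun a ha _ b hb _ ↦ ?_, ?_⟩
  · rw [Finset.mem_singleton.1 ha, mem_nbrsIn, and_iff_right hb]
  · rw [sdiff_nbrsIn]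
    cases L with
    | nil => exact h
    | cons B L =>
      obtain ⟨hBW, hB, hadj, htail⟩ := h
      refine ⟨hBW, hB, fun a ha _ b hb hbS ↦ ?_, htail⟩
      have hvS : v ∉ S := fun hvS ↦ notMem_unseen_of_mem_nbrsIn hv (hS hvS)
      rw [← hadj v (Finset.mem_singleton_self v) hvS b hb hbS]
      have := Finset.ext_iff.1 (hhom a ha v hv) b
      simpa only [mem_nbrsIn, hb, true_and] using this

/- To attach a new root `x`, delete its neighbours and the first cluster, so that nothing is left of
either side of the only new adjacency condition. -/
theorem exists_change_root {W' : Finset V} (hW' : W' ⊆ W) (hS : S ⊆ W')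
    (h : IsClusterChain G S W' Q L) (x : V) :
    ∃ T ⊆ W, T.card + W'.card ≤ S.card + W.card + (nbrsIn G W x).card + 3 ∧
      IsClusterChain G T W {x} L := by
  classical
  have hsdiff := Finset.card_sdiff_add_card_eq_card hW'
  have hcard := Finset.card_union_le S (W \ W')
  have hsub : S ∪ W \ W' ⊆ W := Finset.union_subset (hS.trans hW') Finset.sdiff_subset
  cases L with
  | nil =>
    refine ⟨S ∪ W \ W', hsub, by omega, fun v hv ↦ ?_⟩
    by_cases hvW : v ∈ W'
    · exact Finset.mem_union_left _ (h hvW)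
    · exact Finset.mem_union_right _ (Finset.mem_sdiff.2 ⟨hv, hvW⟩)
  | cons B L =>
    obtain ⟨hBW, hB, -, htail⟩ := h
    refine ⟨S ∪ W \ W' ∪ (nbrsIn G W x ∪ B), Finset.union_subset hsub (Finset.union_subset
      (fun u hu ↦ (mem_nbrsIn.1 hu).1) (hBW.trans hW')), ?_, hBW.trans hW', hB, ?_, ?_⟩
    · have := Finset.card_union_le (nbrsIn G W x) B
      have := Finset.card_union_le (S ∪ W \ W') (nbrsIn G W x ∪ B)
      omega
    · intro a ha _ b hb hbT
      rw [Finset.mem_singleton.1 ha]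
      simp only [Finset.mem_union, not_or, mem_nbrsIn, hb, true_and] at hbT
      exact iff_of_false hbT.2.1 hbT.2.2
    · refine htail.mono (fun v hv ↦ by simp [hv]) (Finset.sdiff_subset_sdiff hW' subset_rfl) ?_
      intro v hv hvT
      simp only [Finset.mem_sdiff, Finset.mem_union] at hv hvT ⊢
      tauto

end IsClusterChain

theorem exists_of_not_pathIrreducible {m J : ℕ} {δ : ℝ} (hδ : 0 ≤ δ)
    (hJ : 1 ≤ pathDensity G w W x * (1 + δ) ^ J) (h : ¬ PathIrreducible G w W x m δ) :
    ∃ j, J = j + 1 ∧ ∃ W' ⊆ W, ∃ x' ∉ W', W.card ≤ W'.card + m ∧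
      pathDensity G w W x ≤ pathDensity G w W' x' ∧ 1 ≤ pathDensity G w W' x' * (1 + δ) ^ j := by
  simp only [PathIrreducible, not_forall, not_le] at h
  obtain ⟨W', hW', x', hx', hWm, hgain⟩ := h
  have hle : pathDensity G w W x ≤ pathDensity G w W' x' := by
    nlinarith [pathDensity_nonneg (G := G) (w := w) (W := W) (x := x)]
  cases J with
  | zero =>
    have : pathDensity G w W' x' ≤ 1 := pathDensity_le_one hx'
    nlinarith
  | succ j =>
    refine ⟨j, rfl, W', hW', x', hx', hWm, hle, hJ.trans ?_⟩
    rw [pow_succ', ← mul_assoc, mul_comm _ (1 + δ)]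
    gcongr

/- Since the density never exceeds `1`, it can be increased by a factor `1 + δ` only boundedly
often. In between, the irreducible stages split off one cluster at a time without any loss. -/
theorem exists_isClusterChain {ρ : ℝ} (hρ : 0 < ρ) :
    ∃ C : ℕ, ∀ {V : Type*} (G : SimpleGraph V) (w : V) (W : Finset V) (x : V),
      x ∉ W → ρ ≤ pathDensity G w W x →
        ∃ S ⊆ W, ∃ L, S.card ≤ C ∧ IsClusterChain G S W {x} L := by
  obtain ⟨m, δ, hδ, hcluster⟩ := PathIrreducible.exists_homogeneousAt hρ
  obtain ⟨D, hD⟩ := exists_card_nbrsIn_le hρ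
  obtain ⟨c, hc⟩ := exists_card_le_of_le_pathDensity_self hρ
  obtain ⟨J, hJ⟩ := pow_unbounded_of_one_lt (1 / ρ) (show 1 < 1 + δ by linarith)
  refine ⟨c + J * (m + D + 3), fun {V} G w W x hx hr ↦ ?_⟩
  have hJ' : 1 ≤ pathDensity G w W x * (1 + δ) ^ J := by
    have := mul_le_mul hr hJ.le (by positivity) pathDensity_nonneg
    rwa [mul_one_div_cancel hρ.ne'] at this
  clear hJ
  induction hn : J + W.card using Nat.strong_induction_on generalizing J W x with
  | _ n ih
  by_cases hxw : x = w
  · subst hxw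
    exact ⟨W, subset_rfl, [], (hc hx hr).trans (Nat.le_add_right _ _), subset_rfl⟩
  by_cases hirr : PathIrreducible G w W x m δ
  · obtain ⟨hcard, hhom⟩ := hcluster hx hxw hr hirr
    obtain ⟨v, hv, hle⟩ := exists_mul_pow_dist_le_pathDensity hx hxw (hρ.trans_le hr)
    rw [hcard, Nat.dist_self, pow_zero, mul_one] at hle
    have hunseen := card_unseen_add_card_nbrsIn (G := G) (W := W) (x := x)
    obtain ⟨S, hS, L, hSC, hL⟩ := ih _ (by omega) J (unseen G W [x]) v
      (notMem_unseen_of_mem_nbrsIn hv) (hr.trans hle)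
      (hJ'.trans (mul_le_mul_of_nonneg_right hle (by positivity))) rfl
    exact ⟨S, hS.trans (unseen_subset _), nbrsIn G W x :: L, hSC,
      hL.cons_of_homogeneousAt hhom hcard hv hS⟩
  · obtain ⟨j, rfl, W', hW', x', hx', hWm, hle, hj⟩ := exists_of_not_pathIrreducible hδ.le hJ' hirr
    have hcard := Finset.card_le_card hW'
    obtain ⟨S, hS, L, hSC, hL⟩ := ih _ (by omega) j W' x' hx' (hr.trans hle) hj rfl
    obtain ⟨T, hT, hTC, hTL⟩ := hL.exists_change_root hW' hS x
    have hnbrs := hD G w W x hx hxw hr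
    refine ⟨T, hT, L, ?_, hTL⟩
    rw [Nat.succ_mul]
    omega

end

/-! ### Induced cycles -/

section

theorem cycleGraph_adj_iff_of_lt {k : ℕ} {i j : Fin k} (hij : i < j) :
    (SimpleGraph.cycleGraph k).Adj i j ↔ (j : ℕ) = i + 1 ∨ (i : ℕ) = 0 ∧ (j : ℕ) + 1 = k := by
  rw [SimpleGraph.cycleGraph_adj', Fin.sub_val_of_le hij.le, Fin.coe_sub_iff_lt.2 hij]
  omega

namespace IsInducedCycle

variable {V : Type*} {G : SimpleGraph V} {S : Finset V} {v : V}

theorem exists_iso_zero (hS : IsInducedCycle G S) (hv : v ∈ S) :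
    ∃ (m : ℕ) (φ : SimpleGraph.cycleGraph (m + 3) ≃g G.induce (S : Set V)), (φ 0 : V) = v := by
  obtain ⟨k, hk, ⟨φ⟩⟩ := hS
  obtain ⟨m, rfl⟩ := Nat.exists_eq_add_of_le' hk
  let rotation : SimpleGraph.cycleGraph (m + 3) ≃g SimpleGraph.cycleGraph (m + 3) :=
    ⟨Equiv.addLeft (φ.symm ⟨v, hv⟩), by simp [SimpleGraph.cycleGraph_adj]⟩
  exact ⟨m, rotation.trans φ, by simp [rotation]⟩

theorem exists_isInducedPath (hS : IsInducedCycle G S) (hv : v ∈ S) :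
    ∃ (u w : V) (l : List V), u ≠ w ∧ IsInducedPath G l ∧ l.head? = some u ∧
      l.getLast? = some w ∧ v ∉ l ∧ (∀ z, z ∈ S ↔ z = v ∨ z ∈ l) ∧
      ∀ z ∈ l, G.Adj v z ↔ z = u ∨ z = w := by
  obtain ⟨m, φ, rfl⟩ := hS.exists_iso_zero hv
  have hinj : Function.Injective fun i ↦ (φ i : V) := Subtype.val_injective.comp φ.injective
  have hadj {i j : Fin (m + 3)} (hij : i < j) :
      G.Adj (φ i) (φ j) ↔ (j : ℕ) = i + 1 ∨ (i : ℕ) = 0 ∧ (j : ℕ) + 1 = m + 3 := by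
    rw [← cycleGraph_adj_iff_of_lt hij, ← φ.map_adj_iff, SimpleGraph.induce_adj]
  refine ⟨φ 1, φ (Fin.last _), List.ofFn fun i : Fin (m + 2) ↦ (φ i.succ : V), ?_, ?_, ?_, ?_,
    ?_, fun z ↦ ?_, ?_⟩
  · exact hinj.ne (by simp [Fin.ext_iff])
  · refine isInducedPath_of_getElem ?_ fun i j hj hij ↦ ?_
    · exact List.nodup_ofFn.2 (hinj.comp (Fin.succ_injective _))
    · rw [List.getElem_ofFn, List.getElem_ofFn, hadj (by simpa using hij)]
      simp
  · simp [List.head?_eq_getElem?]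
  · rw [List.getLast?_eq_getElem?, List.length_ofFn, List.getElem?_ofFn]
    simp only [Nat.add_one_sub_one, Nat.lt_add_one, dite_true]
    rfl
  · simp only [List.mem_ofFn, not_exists]
    exact fun i ↦ hinj.ne i.succ_ne_zero
  · rw [List.mem_ofFn]
    refine ⟨fun hz ↦ ?_, ?_⟩
    · obtain ⟨i, hi⟩ := φ.surjective ⟨z, hz⟩
      rcases i.eq_zero_or_eq_succ with rfl | ⟨j, rfl⟩
      · exact .inl (congrArg Subtype.val hi).symm
      · exact .inr ⟨j, congrArg Subtype.val hi⟩
    · rintro (rfl | ⟨j, rfl⟩)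
      · exact hv
      · exact (φ _).2
  · rintro _ hz
    obtain ⟨i, rfl⟩ := List.mem_ofFn.1 hz
    rw [hadj i.succ_pos, hinj.eq_iff, hinj.eq_iff, Fin.ext_iff, Fin.ext_iff]
    simp

end IsInducedCycle

open scoped Classical in
/-- The vertex sets contained in `W` of the induced cycles of `G`. -/
noncomputable def inducedCycles {V : Type*} (G : SimpleGraph V) (W : Finset V) :
    Finset (Finset V) :=
  W.powerset.filter (IsInducedCycle G)

variable {V : Type*} {G : SimpleGraph V} {W : Finset V} {v : V}

theorem mem_inducedCycles {S : Finset V} :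
    S ∈ inducedCycles G W ↔ S ⊆ W ∧ IsInducedCycle G S := by
  simp [inducedCycles]

theorem inducedCycles_empty : inducedCycles G ∅ = ∅ := by
  refine Finset.eq_empty_of_forall_notMem fun S hS ↦ ?_
  obtain ⟨hS, k, hk, ⟨φ⟩⟩ := mem_inducedCycles.1 hS
  exact Finset.notMem_empty _ (hS (φ ⟨0, by omega⟩).2)

theorem numInducedCycles_eq_card [Fintype V] (G : SimpleGraph V) :
    numInducedCycles G = (inducedCycles G Finset.univ).card := by
  rw [numInducedCycles, ← Set.ncard_coe_finset]
  congr 1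
  ext S
  simp [mem_inducedCycles]

theorem IsInducedCycle.exists_mem_inducedPaths [DecidableEq V] {S : Finset V}
    (hS : IsInducedCycle G S) (hv : v ∈ S) (hSW : S ⊆ insert v W) :
    ∃ p ∈ (nbrsIn G W v).offDiag, ∃ l ∈ inducedPaths G p.2 (insert p.2 (unseen G W [v])) p.1,
      insert v l.toFinset = S := by
  obtain ⟨u, w, l, huw, hl, hhead, hlast, hvl, hmem, hadj⟩ := hS.exists_isInducedPath hv
  have hlW : ∀ z ∈ l, z ∈ W := fun z hz ↦
    Finset.mem_of_mem_insert_of_ne (hSW ((hmem z).2 (.inr hz))) fun h ↦ hvl (h ▸ hz)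
  have hul := List.mem_of_mem_head? hhead
  have hwl := List.mem_of_mem_getLast? hlast
  have hu : u ∈ nbrsIn G W v := mem_nbrsIn.2 ⟨hlW u hul, (hadj u hul).2 (.inl rfl)⟩
  have hw : w ∈ nbrsIn G W v := mem_nbrsIn.2 ⟨hlW w hwl, (hadj w hwl).2 (.inr rfl)⟩
  have htail : ∀ c ∈ l.tail, c ∈ insert w (unseen G W [v]) := by
    intro c hc
    obtain ⟨T, rfl⟩ := List.head?_eq_some_iff.1 hhead
    have hcu : c ≠ u := fun h ↦ hl.1 (h ▸ hc)
    have hcl := List.mem_of_mem_tail hc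
    rw [Finset.mem_insert, mem_unseen_singleton, hadj c hcl]
    have := hlW c hcl
    tauto
  refine ⟨(u, w), Finset.mem_offDiag.2 ⟨hu, hw, huw⟩, l,
    mem_inducedPaths.2 ⟨⟨hl, hhead, htail⟩, hlast⟩, ?_⟩
  ext z
  simp [hmem]

theorem card_inducedCycles_insert_le [DecidableEq V] :
    (inducedCycles G (insert v W)).card ≤ (inducedCycles G W).card +
      ∑ p ∈ (nbrsIn G W v).offDiag,
        (inducedPaths G p.2 (insert p.2 (unseen G W [v])) p.1).card := by
  have hsub : inducedCycles G (insert v W) ⊆ inducedCycles G W ∪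
      (nbrsIn G W v).offDiag.biUnion fun p ↦
        (inducedPaths G p.2 (insert p.2 (unseen G W [v])) p.1).image fun l ↦
          insert v l.toFinset := by
    intro S hS
    obtain ⟨hSW, hS⟩ := mem_inducedCycles.1 hS
    rw [Finset.mem_union]
    by_cases hvS : v ∈ S
    · right
      obtain ⟨p, hp, l, hl, rfl⟩ := hS.exists_mem_inducedPaths hvS hSW
      exact Finset.mem_biUnion.2 ⟨p, hp, Finset.mem_image_of_mem _ hl⟩
    · exact .inl (mem_inducedCycles.2 ⟨(Finset.subset_insert_iff_of_notMem hvS).1 hSW, hS⟩)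
  refine (Finset.card_le_card hsub).trans ((Finset.card_union_le _ _).trans ?_)
  gcongr
  exact Finset.card_biUnion_le.trans (Finset.sum_le_sum fun p _ ↦ Finset.card_image_le)

theorem exists_sq_le_mul_pow {r : ℝ} (hr : 1 < r) :
    ∃ K : ℝ, 0 < K ∧ ∀ d : ℕ, (d : ℝ) ^ 2 ≤ K * r ^ d := by
  have hlim := tendsto_pow_const_div_const_pow_of_one_lt 2 hr
  obtain ⟨K, hK⟩ := hlim.bddAbove_range
  refine ⟨max K 1, by positivity, fun d ↦ ?_⟩
  have hd : (d : ℝ) ^ 2 / r ^ d ≤ max K 1 := (hK ⟨d, rfl⟩).trans (le_max_left _ _)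
  rwa [div_le_iff₀ (by positivity)] at hd

/- The geometric mean of the assumed bound and the one from `card_inducedPaths_le`. -/
theorem card_inducedPaths_insert_unseen_le {B : ℝ} (hB : 0 ≤ B) (hv : v ∉ W)
    (hpaths : ∀ (u w : V) (U : Finset V), v ≠ u → v ∉ U → u ∉ U →
      ((inducedPaths G w U u).card : ℝ) ≤ B ^ 2) [DecidableEq V] {u w : V}
    (hu : u ∈ nbrsIn G W v) (hw : w ∈ nbrsIn G W v) (huw : u ≠ w) :
    ((inducedPaths G w (insert w (unseen G W [v])) u).card : ℝ) ≤
      B * √cbrtThree ^ ((unseen G W [v]).card + 1) := by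
  set U := insert w (unseen G W [v])
  have hU : U.card = (unseen G W [v]).card + 1 :=
    Finset.card_insert_of_notMem (notMem_unseen_of_mem_nbrsIn hw)
  have huU : u ∉ U := by
    simp only [U, Finset.mem_insert, not_or]
    exact ⟨huw, notMem_unseen_of_mem_nbrsIn hu⟩
  have hvU : v ∉ U := by
    simp only [U, Finset.mem_insert, not_or]
    exact ⟨(mem_nbrsIn.1 hw).2.ne, fun h ↦ hv (unseen_subset _ h)⟩
  refine le_of_pow_le_pow_left₀ two_ne_zero (by positivity) ?_
  calc ((inducedPaths G w U u).card : ℝ) ^ 2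
      ≤ B ^ 2 * cbrtThree ^ U.card := by
        rw [sq]
        exact mul_le_mul (hpaths u w U (mem_nbrsIn.1 hu).2.ne hvU huU)
          (card_inducedPaths_le huU) (Nat.cast_nonneg _) (sq_nonneg B)
    _ = (B * √cbrtThree ^ ((unseen G W [v]).card + 1)) ^ 2 := by
        rw [hU, mul_pow, pow_right_comm, Real.sq_sqrt cbrtThree_pos.le]

theorem sum_card_inducedPaths_le {K B : ℝ}
    (hK : ∀ d : ℕ, (d : ℝ) ^ 2 ≤ K * √cbrtThree ^ d) (hB : 0 ≤ B) (hv : v ∉ W)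
    (hpaths : ∀ (u w : V) (U : Finset V), v ≠ u → v ∉ U → u ∉ U →
      ((inducedPaths G w U u).card : ℝ) ≤ B ^ 2) [DecidableEq V] :
    ∑ p ∈ (nbrsIn G W v).offDiag,
      ((inducedPaths G p.2 (insert p.2 (unseen G W [v])) p.1).card : ℝ) ≤
        K * B * √cbrtThree * √cbrtThree ^ W.card := by
  set e := √cbrtThree
  have he : 0 < e := Real.sqrt_pos.2 cbrtThree_pos
  have hoffDiag : ((nbrsIn G W v).offDiag.card : ℝ) ≤ K * e ^ (nbrsIn G W v).card := by
    refine le_trans ?_ (hK _)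
    rw [Finset.offDiag_card, sq]
    exact_mod_cast Nat.sub_le _ _
  calc _ ≤ (nbrsIn G W v).offDiag.card * (B * e ^ ((unseen G W [v]).card + 1)) := by
        rw [← nsmul_eq_mul]
        refine Finset.sum_le_card_nsmul _ _ _ fun p hp ↦ ?_
        obtain ⟨hu, hw, huw⟩ := Finset.mem_offDiag.1 hp
        exact card_inducedPaths_insert_unseen_le hB hv hpaths hu hw huw
    _ ≤ K * e ^ (nbrsIn G W v).card * (B * e ^ ((unseen G W [v]).card + 1)) := by gcongr
    _ = K * B * e * e ^ W.card := by
        rw [← card_unseen_add_card_nbrsIn (G := G) (W := W) (x := v)]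
        ring

theorem exists_card_inducedCycles_le :
    ∃ K : ℝ, 0 < K ∧ ∀ {V : Type*} {G : SimpleGraph V} {W : Finset V} {B : ℝ}, 0 ≤ B →
      (∀ (v u w : V) (U : Finset V), v ≠ u → v ∉ U → u ∉ U →
        ((inducedPaths G w U u).card : ℝ) ≤ B ^ 2) →
      ((inducedCycles G W).card : ℝ) ≤ K * B * √cbrtThree ^ W.card := by
  have he : 1 < √cbrtThree := by
    rw [Real.lt_sqrt zero_le_one, one_pow]
    exact one_lt_cbrtThree
  obtain ⟨K, hK, hKd⟩ := exists_sq_le_mul_pow he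
  set e := √cbrtThree
  have he' : 0 < e - 1 := sub_pos.2 he
  refine ⟨K * e / (e - 1), by positivity, fun {V G W B} hB hpaths ↦ ?_⟩
  classical
  induction W using Finset.induction_on with
  | empty =>
    rw [inducedCycles_empty, Finset.card_empty, Nat.cast_zero]
    positivity
  | insert v W hv ih =>
    have hstep := sum_card_inducedPaths_le hKd hB hv (hpaths v)
    calc ((inducedCycles G (insert v W)).card : ℝ)
        ≤ (inducedCycles G W).card + ∑ p ∈ (nbrsIn G W v).offDiag,
            ((inducedPaths G p.2 (insert p.2 (unseen G W [v])) p.1).card : ℝ) := by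
          exact_mod_cast card_inducedCycles_insert_le
      _ ≤ K * e / (e - 1) * B * e ^ W.card + K * B * e * e ^ W.card := add_le_add ih hstep
      _ = K * e / (e - 1) * B * e ^ (insert v W).card := by
          rw [Finset.card_insert_of_notMem hv]
          field_simp
          ring

theorem exists_mul_le_card_inducedPaths {α : ℝ} (hα : 0 < α) :
    ∃ ρ : ℝ, 0 < ρ ∧ ∀ {V : Type*} [Fintype V] (G : SimpleGraph V),
      α * cbrtThree ^ Fintype.card V ≤ numInducedCycles G →
        ∃ (v u w : V) (W : Finset V), v ≠ u ∧ v ∉ W ∧ u ∉ W ∧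
          ρ * cbrtThree ^ Fintype.card V ≤ (inducedPaths G w W u).card := by
  obtain ⟨K, hK, hcycles⟩ := exists_card_inducedCycles_le
  refine ⟨(α / (2 * K)) ^ 2, by positivity, fun {V} _ G hG ↦ ?_⟩
  by_contra! hfew
  set e := √cbrtThree
  have he2 : e ^ 2 = cbrtThree := Real.sq_sqrt cbrtThree_pos.le
  have hpos : 0 < α * cbrtThree ^ Fintype.card V := mul_pos hα (pow_pos cbrtThree_pos _)
  have : α * cbrtThree ^ Fintype.card V ≤ α * cbrtThree ^ Fintype.card V / 2 := calc
    _ ≤ ((inducedCycles G Finset.univ).card : ℝ) := by rwa [← numInducedCycles_eq_card]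
    _ ≤ K * (α / (2 * K) * e ^ Fintype.card V) * e ^ Fintype.card V := by
        refine hcycles (W := Finset.univ) (by positivity) fun v u w U hvu hvU huU ↦ ?_
        refine (hfew v u w U hvu hvU huU).le.trans_eq ?_
        rw [mul_pow, pow_right_comm e, he2]
    _ = α * cbrtThree ^ Fintype.card V / 2 := by
        rw [← he2, pow_right_comm]
        field_simp
  linarith

end

theorem isInducedCycle_of_embedding {V : Type*} {G : SimpleGraph V} {k : ℕ} (hk : 3 ≤ k)
    (f : SimpleGraph.cycleGraph k ↪g G) : IsInducedCycle G (Finset.univ.map f.toEmbedding) := by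
  refine ⟨k, hk, ?_⟩
  rw [Finset.coe_map, Finset.coe_univ, Set.image_univ]
  exact ⟨f.isoInduceRange⟩

/- A blow-up of a `k`-cycle contains the `k`-cycles that take one vertex from each class. -/
theorem pow_le_numInducedCycles {V : Type*} [Finite V] {G : SimpleGraph V} {k d : ℕ} (hk : 3 ≤ k)
    (f : (SimpleGraph.cycleGraph k).comap (Prod.fst : Fin k × Fin d → Fin k) ↪g G) :
    d ^ k ≤ numInducedCycles G := by
  let transversal (g : Fin k → Fin d) : SimpleGraph.cycleGraph k ↪g G :=
    f.comp ⟨⟨fun i ↦ (i, g i), fun i j h ↦ congrArg Prod.fst h⟩, Iff.rfl⟩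
  let vertices (g : Fin k → Fin d) : Finset V := Finset.univ.map (transversal g).toEmbedding
  have hinj : Function.Injective vertices := by
    intro g g' h
    funext i
    have hi : f (i, g i) ∈ vertices g' := by
      rw [← h]
      exact Finset.mem_map_of_mem _ (Finset.mem_univ i)
    obtain ⟨j, -, hj⟩ := Finset.mem_map.1 hi
    obtain ⟨rfl, hj⟩ := Prod.ext_iff.1 (f.injective hj)
    exact hj.symm
  have hrange : Set.range vertices ⊆ {S | IsInducedCycle G S} :=
    Set.range_subset_iff.2 fun g ↦ isInducedCycle_of_embedding hk (transversal g)
  calc d ^ k = (Set.range vertices).ncard := by simp [Set.ncard_range_of_injective hinj]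
    _ ≤ numInducedCycles G := Set.ncard_le_ncard hrange

theorem three_pow_le_maxInducedCycles {n : ℕ} (hn : 9 ≤ n) :
    3 ^ (n / 3) ≤ maxInducedCycles n := by
  obtain ⟨f⟩ : Nonempty (Fin (n / 3) × Fin 3 ↪ Fin n) :=
    Function.Embedding.nonempty_of_card_le (by simpa using Nat.div_mul_le_self n 3)
  let G := (SimpleGraph.cycleGraph (n / 3)).comap (Prod.fst : Fin (n / 3) × Fin 3 → Fin (n / 3))
  calc 3 ^ (n / 3) ≤ numInducedCycles (G.map f) :=
        pow_le_numInducedCycles (by omega) (SimpleGraph.Embedding.map f G)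
    _ ≤ maxInducedCycles n := le_csSup (Set.finite_range _).bddAbove ⟨G.map f, rfl⟩

theorem cbrtThree_pow_le_mul_maxInducedCycles {n : ℕ} (hn : 9 ≤ n) :
    cbrtThree ^ n ≤ 3 * maxInducedCycles n := by
  calc cbrtThree ^ n ≤ cbrtThree ^ (3 * (n / 3 + 1)) :=
        pow_le_pow_right₀ one_lt_cbrtThree.le (by omega)
    _ = 3 * 3 ^ (n / 3) := by rw [pow_mul, cbrtThree_pow_three, pow_succ']
    _ ≤ 3 * maxInducedCycles n := by
        gcongr
        exact_mod_cast three_pow_le_maxInducedCycles hn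

/-! ### Cyclic braids -/

theorem cycleGraph_adj_iff_finRotate {k : ℕ} (hk : 3 ≤ k) {i j : Fin k} :
    (SimpleGraph.cycleGraph k).Adj i j ↔ finRotate k i = j ∨ finRotate k j = i := by
  obtain ⟨m, rfl⟩ := Nat.exists_eq_add_of_le' hk
  rw [SimpleGraph.cycleGraph_adj, finRotate_apply, finRotate_apply, sub_eq_iff_eq_add,
    sub_eq_iff_eq_add, add_comm 1 j, add_comm 1 i, or_comm, eq_comm, @eq_comm _ i]

theorem isCyclicBraid_of_adj_iff {V : Type*} {G : SimpleGraph V} {k : ℕ} (hk : 3 ≤ k)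
    {B : Fin k → Finset V} (hne : ∀ i, (B i).Nonempty) {c : V → Fin k}
    (hc : ∀ v i, v ∈ B i ↔ c v = i)
    (hG : ∀ u v, c u ≠ c v → (G.Adj u v ↔ (SimpleGraph.cycleGraph k).Adj (c u) (c v))) :
    IsCyclicBraid G B := by
  have hmem (i : Fin k) (y : V) :
      y ∈ (B ((finRotate k).symm i) ∪ B (finRotate k i) : Set V) ↔
        (SimpleGraph.cycleGraph k).Adj i (c y) := by
    rw [Set.mem_union, Finset.mem_coe, Finset.mem_coe, hc, hc, Equiv.eq_symm_apply,
      cycleGraph_adj_iff_finRotate hk, or_comm, eq_comm]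
  refine ⟨hk, hne, fun v ↦ ⟨c v, (hc v _).2 rfl, fun i hi ↦ ((hc v i).1 hi).symm⟩,
    fun i x hx y hy ↦ ?_, fun i x hx y hy ↦ ?_⟩
  · obtain rfl := (hc x i).1 hx
    have hy := (hmem _ y).1 hy
    exact (hG x y hy.ne).2 hy
  · obtain rfl := (hc x i).1 hx
    rw [Set.union_right_comm, Set.mem_union, hmem, Finset.mem_coe, hc]
    by_cases hxy : c x = c y
    · exact .inr hxy.symm
    · exact .inl ((hG x y hxy).1 hy)

/-- The graph that agrees with `H` on the pairs of vertices meeting `S` and with `G` on all other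
pairs. -/
def replaceAt {V : Type*} (G H : SimpleGraph V) (S : Finset V) : SimpleGraph V where
  Adj u v := (u ∈ S ∨ v ∈ S) ∧ H.Adj u v ∨ ¬(u ∈ S ∨ v ∈ S) ∧ G.Adj u v
  symm := ⟨fun u v h ↦ by rwa [or_comm (a := v ∈ S), H.adj_comm, G.adj_comm]⟩
  loopless := ⟨fun u h ↦ by simp at h⟩

theorem exists_isCyclicBraid {V : Type*} {G : SimpleGraph V} {S : Finset V} {k : ℕ} (hk : 3 ≤ k)
    {B : Fin k → Finset V} (hne : ∀ i, (B i).Nonempty) {c : V → Fin k}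
    (hc : ∀ v i, v ∈ B i ↔ c v = i)
    (hG : ∀ u v, u ∉ S → v ∉ S → c u < c v →
      (G.Adj u v ↔ (SimpleGraph.cycleGraph k).Adj (c u) (c v))) :
    ∃ G' : SimpleGraph V, (∀ u v, u ∉ S → v ∉ S → (G'.Adj u v ↔ G.Adj u v)) ∧
      IsCyclicBraid G' B := by
  refine ⟨replaceAt G ((SimpleGraph.cycleGraph k).comap c) S, fun u v hu hv ↦ ?_,
    isCyclicBraid_of_adj_iff hk hne hc fun u v huv ↦ ?_⟩
  · simp [replaceAt, hu, hv]
  · by_cases hS : u ∈ S ∨ v ∈ S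
    · simp only [replaceAt, hS, true_and, not_true, false_and, or_false, SimpleGraph.comap_adj]
    · obtain ⟨hu, hv⟩ := not_or.1 hS
      simp only [replaceAt, hS, not_false_iff, true_and, false_and, false_or]
      rcases huv.lt_or_gt with hlt | hlt
      · exact hG u v hu hv hlt
      · rw [G.adj_comm, hG v u hv hu hlt, SimpleGraph.adj_comm]

theorem exists_list_pairwise_disjoint {V : Type*} (R : Finset V) {l : List ℕ}
    (hl : l.sum = R.card) : ∃ L : List (Finset V), L.map Finset.card = l ∧
      L.Pairwise Disjoint ∧ ∀ v, v ∈ R ↔ ∃ B ∈ L, v ∈ B := by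
  classical
  induction l generalizing R with
  | nil =>
    obtain rfl := Finset.card_eq_zero.1 hl.symm
    exact ⟨[], rfl, .nil, by simp⟩
  | cons a l ih =>
    rw [List.sum_cons] at hl
    obtain ⟨B, hBR, rfl⟩ := Finset.exists_subset_card_eq (s := R) (n := a) (by omega)
    obtain ⟨L, hcard, hL, hmem⟩ := ih (R \ B) (by rw [Finset.card_sdiff_of_subset hBR]; omega)
    refine ⟨B :: L, by rw [List.map_cons, hcard], .cons (fun B' hB' ↦ ?_) hL, fun v ↦ ?_⟩
    · rw [Finset.disjoint_right]
      exact fun v hv ↦ (Finset.mem_sdiff.1 ((hmem v).2 ⟨B', hB', hv⟩)).2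
    · rw [List.exists_mem_cons_iff, ← hmem, Finset.mem_sdiff]
      have := @hBR v
      tauto

theorem exists_forall_mem_get_iff {V : Type*} {L : List (Finset V)} (hL : L.Pairwise Disjoint)
    (hcover : ∀ v, ∃ B ∈ L, v ∈ B) : ∃ c : V → Fin L.length, ∀ v i, v ∈ L.get i ↔ c v = i := by
  have hindex (v : V) : ∃ i, v ∈ L.get i := by
    obtain ⟨B, hB, hv⟩ := hcover v
    obtain ⟨i, rfl⟩ := List.get_of_mem hB
    exact ⟨i, hv⟩
  choose c hc using hindex
  refine ⟨c, fun v i ↦ ⟨fun hv ↦ ?_, fun h ↦ h ▸ hc v⟩⟩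
  by_contra hne
  rcases lt_or_gt_of_ne hne with hlt | hlt
  · exact Finset.disjoint_left.1 (List.pairwise_iff_get.1 hL _ _ hlt) (hc v) hv
  · exact Finset.disjoint_left.1 (List.pairwise_iff_get.1 hL _ _ hlt) hv (hc v)

theorem exists_sizes_eq_extremalClusterSizes {r t : ℕ} (hr : 2 ≤ r) :
    ∃ l : List ℕ, l.sum = r ∧ l ≠ [] ∧
      ((l ++ List.replicate t 3 : List ℕ) : Multiset ℕ) = extremalClusterSizes (r + 3 * t) := by
  unfold extremalClusterSizes
  split_ifs with h0 h1
  · refine ⟨List.replicate (r / 3) 3, by simp; omega, by simp; omega, ?_⟩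
    rw [List.replicate_append_replicate, Multiset.coe_replicate]
    congr 1
    omega
  · refine ⟨4 :: List.replicate (r / 3 - 1) 3, by simp; omega, by simp, ?_⟩
    rw [List.cons_append, List.replicate_append_replicate, ← Multiset.cons_coe,
      Multiset.coe_replicate]
    congr 2
    omega
  · refine ⟨2 :: List.replicate (r / 3) 3, by simp; omega, by simp, ?_⟩
    rw [List.cons_append, List.replicate_append_replicate, ← Multiset.cons_coe,
      Multiset.coe_replicate]
    congr 2
    omega

theorem le_card_extremalClusterSizes (n : ℕ) : n / 3 ≤ (extremalClusterSizes n).card := by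
  unfold extremalClusterSizes
  split_ifs
  · simp
  · simp only [Multiset.card_cons, Multiset.card_replicate]
    omega
  · simp

theorem pos_of_mem_extremalClusterSizes {n a : ℕ} (ha : a ∈ extremalClusterSizes n) : 0 < a := by
  unfold extremalClusterSizes at ha
  split_ifs at ha <;> simp only [Multiset.mem_cons, Multiset.mem_replicate] at ha <;> omega

theorem clusterSizes_get {V : Type*} (L : List (Finset V)) :
    clusterSizes L.get = (L.map Finset.card : Multiset ℕ) := by
  have h := List.map_ofFn (f := L.get) (g := Finset.card)
  rw [List.ofFn_get] at h
  rw [clusterSizes, Fin.univ_val_map, h, Function.comp_def]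

namespace IsClusterChain

variable {V : Type*} {G : SimpleGraph V} {S W Q : Finset V} {L : List (Finset V)}

theorem subset (h : IsClusterChain G S W Q L) : ∀ B ∈ L, B ⊆ W := by
  classical
  induction L generalizing W Q with
  | nil => simp
  | cons B L ih =>
    obtain ⟨hBW, -, -, htail⟩ := h
    exact List.forall_mem_cons.2
      ⟨hBW, fun B' hB' ↦ (ih htail B' hB').trans Finset.sdiff_subset⟩

theorem map_card (h : IsClusterChain G S W Q L) :
    L.map Finset.card = List.replicate L.length 3 := by
  induction L generalizing W Q with
  | nil => rfl
  | cons B L ih =>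
    obtain ⟨-, hB, -, htail⟩ := h
    rw [List.map_cons, hB, ih htail, List.length_cons, List.replicate_succ]

theorem pairwise_disjoint (h : IsClusterChain G S W Q L) : L.Pairwise Disjoint := by
  classical
  induction L generalizing W Q with
  | nil => exact .nil
  | cons B L ih =>
    obtain ⟨-, -, -, htail⟩ := h
    exact .cons (fun B' hB' ↦ Finset.disjoint_sdiff.mono_right (htail.subset B' hB')) (ih htail)

theorem exists_remainder (h : IsClusterChain G S W Q L) :
    ∃ R ⊆ S, R.card + 3 * L.length = W.card ∧ ∀ v, v ∈ R ↔ v ∈ W ∧ ¬∃ B ∈ L, v ∈ B := by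
  classical
  induction L generalizing W Q with
  | nil => exact ⟨W, h, by simp, by simp⟩
  | cons B L ih =>
    obtain ⟨hBW, hB, -, htail⟩ := h
    obtain ⟨R, hRS, hcard, hmem⟩ := ih htail
    refine ⟨R, hRS, ?_, fun v ↦ ?_⟩
    · have hWB := Finset.card_sdiff_add_card_eq_card hBW
      rw [List.length_cons]
      omega
    · rw [hmem, Finset.mem_sdiff, List.exists_mem_cons_iff, not_or, and_assoc]

theorem adj_iff_eq_zero (h : IsClusterChain G S W Q L) {a b : V} (ha : a ∈ Q) (haS : a ∉ S)
    (hbS : b ∉ S) {j : ℕ} (hj : j < L.length) (hb : b ∈ L[j]) : G.Adj a b ↔ j = 0 := by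
  obtain _ | ⟨B, L⟩ := L
  · simp at hj
  have hbW := h.subset _ (List.getElem_mem hj) hb
  have hdisj := (List.pairwise_cons.1 h.pairwise_disjoint).1
  obtain ⟨-, -, hadj, -⟩ := h
  rw [hadj a ha haS b hbW hbS]
  obtain _ | j := j
  · simpa using hb
  · rw [List.getElem_cons_succ] at hb
    simpa using fun hbB ↦ Finset.disjoint_left.1 (hdisj _ (List.getElem_mem _)) hbB hb

theorem adj_iff (h : IsClusterChain G S W Q L) {a b : V} (haS : a ∉ S) (hbS : b ∉ S) {i j : ℕ}
    (hij : i < j) (hj : j < L.length) (ha : a ∈ L[i]) (hb : b ∈ L[j]) :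
    G.Adj a b ↔ j = i + 1 := by
  induction L generalizing W Q i j with
  | nil => simp at hj
  | cons B L ih =>
    obtain ⟨-, -, -, htail⟩ := h
    obtain _ | j := j
    · omega
    rw [List.length_cons, add_lt_add_iff_right] at hj
    obtain _ | i := i
    · rw [htail.adj_iff_eq_zero ha haS hbS hj hb, zero_add, Nat.add_eq_right]
    · rw [ih htail (by omega) hj ha hb, Nat.add_right_cancel_iff]

theorem exists_completion [Fintype V] (h : IsClusterChain G S W Q L) [DecidableEq V]
    (hWS : Wᶜ ⊆ S) (hW : 2 ≤ Wᶜ.card) :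
    ∃ M : List (Finset V), M ≠ [] ∧ (∀ B ∈ M, B ⊆ S) ∧ (M ++ L).Pairwise Disjoint ∧
      (∀ v, ∃ B ∈ M ++ L, v ∈ B) ∧
      ((M ++ L).map Finset.card : Multiset ℕ) = extremalClusterSizes (Fintype.card V) := by
  obtain ⟨R, hRS, hRcard, hR⟩ := h.exists_remainder
  have hdisj : Disjoint R Wᶜ :=
    disjoint_compl_right.mono_left fun v hv ↦ ((hR v).1 hv).1
  have hcard := Finset.card_union_of_disjoint hdisj
  have hWcard := Finset.card_add_card_compl W
  obtain ⟨l, hl, hne, hsizes⟩ := exists_sizes_eq_extremalClusterSizes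
    (r := (R ∪ Wᶜ).card) (t := L.length) (by omega)
  obtain ⟨M, rfl, hM, hMmem⟩ := exists_list_pairwise_disjoint _ hl
  have hmem (v : V) : (∃ B ∈ M, v ∈ B) ↔ ¬∃ B ∈ L, v ∈ B := by
    rw [← hMmem, Finset.mem_union, hR, Finset.mem_compl]
    have hW : v ∉ W → ¬∃ B ∈ L, v ∈ B := fun hvW ⟨B, hB, hv⟩ ↦ hvW (h.subset B hB hv)
    by_cases hv : v ∈ W <;> simp only [hv, true_and, not_true, or_false, false_and, false_or,
      not_false_iff, hW]
  refine ⟨M, by simpa using hne, fun B hB v hv ↦ ?_, ?_, fun v ↦ ?_, ?_⟩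
  · exact Finset.union_subset hRS hWS ((hMmem v).2 ⟨B, hB, hv⟩)
  · refine List.pairwise_append.2 ⟨hM, h.pairwise_disjoint, fun A hA B hB ↦ ?_⟩
    exact Finset.disjoint_left.2 fun v hvA hvB ↦ (hmem v).1 ⟨A, hA, hvA⟩ ⟨B, hB, hvB⟩
  · by_cases hv : ∃ B ∈ L, v ∈ B
    · exact hv.imp fun B ↦ And.imp_left (List.mem_append_right M)
    · exact ((hmem v).2 hv).imp fun B ↦ And.imp_left (List.mem_append_left L)
  · rw [List.map_append, h.map_card, hsizes]
    congr 1
    omega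

/- The chain starts after the clusters `M` that lie in `S`, so its first and last cluster are not
consecutive in the cyclic order. -/
theorem adj_iff_cycleGraph_adj (h : IsClusterChain G S W Q L) {M : List (Finset V)}
    (hM : M ≠ []) (hMS : ∀ B ∈ M, B ⊆ S) {u v : V}
    {i j : Fin (M ++ L).length} (hu : u ∈ (M ++ L).get i) (hv : v ∈ (M ++ L).get j) (huS : u ∉ S)
    (hvS : v ∉ S) (hij : i < j) :
    G.Adj u v ↔ (SimpleGraph.cycleGraph (M ++ L).length).Adj i j := by
  have hle {z : V} {i : Fin (M ++ L).length} (hz : z ∈ (M ++ L).get i) (hzS : z ∉ S) :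
      M.length ≤ i := by
    by_contra! hlt
    rw [List.get_eq_getElem, List.getElem_append_left hlt] at hz
    exact hzS (hMS _ (List.getElem_mem hlt) hz)
  have hi := hle hu huS
  have hj := hle hv hvS
  have hM := List.length_pos_iff.2 hM
  have hcycle : (SimpleGraph.cycleGraph (M ++ L).length).Adj i j ↔ (j : ℕ) = i + 1 := by
    rw [cycleGraph_adj_iff_of_lt hij]
    omega
  have hjlt := j.2.trans_eq List.length_append
  rw [List.get_eq_getElem, List.getElem_append_right hi] at hu
  rw [List.get_eq_getElem, List.getElem_append_right hj] at hv
  rw [hcycle, h.adj_iff huS hvS (by omega) (by omega) hu hv]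
  omega

theorem exists_isCyclicBraid [Fintype V] (hV : 9 ≤ Fintype.card V)
    (h : IsClusterChain G S W Q L) [DecidableEq V] (hWS : Wᶜ ⊆ S) (hW : 2 ≤ Wᶜ.card) :
    ∃ G' : SimpleGraph V, (∀ u v, u ∉ S → v ∉ S → (G'.Adj u v ↔ G.Adj u v)) ∧
      ∃ (k : ℕ) (B : Fin k → Finset V),
        IsCyclicBraid G' B ∧ clusterSizes B = extremalClusterSizes (Fintype.card V) := by
  obtain ⟨M, hM, hMS, hdisj, hcover, hsizes⟩ := h.exists_completion hWS hW
  obtain ⟨c, hc⟩ := exists_forall_mem_get_iff hdisj hcover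
  have hlen : 3 ≤ (M ++ L).length := by
    have hle := le_card_extremalClusterSizes (Fintype.card V)
    rw [← hsizes, Multiset.coe_card, List.length_map] at hle
    omega
  have hne (i : Fin (M ++ L).length) : ((M ++ L).get i).Nonempty := by
    refine Finset.card_pos.1 (pos_of_mem_extremalClusterSizes (n := Fintype.card V) ?_)
    rw [← hsizes, Multiset.mem_coe]
    exact List.mem_map_of_mem (List.get_mem _ _)
  have hadj (u v : V) (hu : u ∉ S) (hv : v ∉ S) (huv : c u < c v) :=
    h.adj_iff_cycleGraph_adj hM hMS ((hc u _).2 rfl) ((hc v _).2 rfl) hu hv huv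
  obtain ⟨G', hG', hbraid⟩ := _root_.exists_isCyclicBraid hlen hne hc hadj
  exact ⟨G', hG', _, _, hbraid, (clusterSizes_get _).trans hsizes⟩

end IsClusterChain

theorem exists_card_compl_le {ρ : ℝ} (hρ : 0 < ρ) :
    ∃ c : ℕ, ∀ {V : Type*} [Fintype V] {G : SimpleGraph V} {W : Finset V} {u w : V}
      [DecidableEq V], u ∉ W →
      ρ * cbrtThree ^ Fintype.card V ≤ (inducedPaths G w W u).card → Wᶜ.card ≤ c := by
  obtain ⟨c, hc⟩ := pow_unbounded_of_one_lt (1 / ρ) one_lt_cbrtThree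
  refine ⟨c, fun {V _ G W u w _} huW hpaths ↦ ?_⟩
  have hW := pow_pos cbrtThree_pos W.card
  have hmul : cbrtThree ^ Wᶜ.card * (ρ * cbrtThree ^ W.card) ≤ 1 * cbrtThree ^ W.card := calc
    _ = ρ * cbrtThree ^ Fintype.card V := by
      rw [← Finset.card_add_card_compl W, pow_add]
      ring
    _ ≤ (inducedPaths G w W u).card := hpaths
    _ ≤ 1 * cbrtThree ^ W.card := by rw [one_mul]; exact card_inducedPaths_le huW
  rw [← mul_assoc, mul_le_mul_iff_left₀ hW, ← le_div_iff₀ hρ] at hmul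
  exact ((pow_lt_pow_iff_right₀ one_lt_cbrtThree).1 (hmul.trans_lt hc)).le

theorem exists_isClusterChain_of_le_numInducedCycles {α : ℝ} (hα : 0 < α) :
    ∃ C : ℕ, ∀ {V : Type*} [Fintype V] {G : SimpleGraph V} [DecidableEq V],
      α * cbrtThree ^ Fintype.card V ≤ numInducedCycles G →
        ∃ (S W Q : Finset V) (L : List (Finset V)), S.card ≤ C ∧ Wᶜ ⊆ S ∧ 2 ≤ Wᶜ.card ∧
          IsClusterChain G S W Q L := by
  obtain ⟨ρ, hρ, hpaths⟩ := exists_mul_le_card_inducedPaths hα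
  obtain ⟨C, hchain⟩ := exists_isClusterChain hρ
  obtain ⟨c, hcompl⟩ := exists_card_compl_le hρ
  refine ⟨C + c, fun {V _ G _} hG ↦ ?_⟩
  obtain ⟨v, u, w, W, hvu, hvW, huW, hcard⟩ := hpaths G hG
  have hdensity : ρ ≤ pathDensity G w W u := by
    rw [pathDensity, le_div_iff₀ (pow_pos cbrtThree_pos _)]
    refine le_trans ?_ hcard
    gcongr
    exacts [one_lt_cbrtThree.le, Finset.card_le_univ W]
  obtain ⟨S, -, L, hS, hL⟩ := hchain G w W u huW hdensity
  refine ⟨S ∪ Wᶜ, W, {u}, L, ?_, Finset.subset_union_right, ?_,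
    hL.mono Finset.subset_union_left subset_rfl fun _ hv _ ↦ hv⟩
  · exact (Finset.card_union_le _ _).trans (add_le_add hS (hcompl huW hcard))
  · exact Finset.one_lt_card.2 ⟨v, by simpa, u, by simpa, hvu⟩

theorem theorem1p4_general {α : ℝ} (hα : 0 < α) :
    ∃ C n₀ : ℕ, ∀ {V : Type*} [Fintype V] (F : SimpleGraph V), n₀ ≤ Fintype.card V →
      α * (maxInducedCycles (Fintype.card V) : ℝ) ≤ (numInducedCycles F : ℝ) →
        ∃ (S : Finset V) (F' : SimpleGraph V),
          S.card ≤ C ∧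
          (∀ u v : V, u ∉ S → v ∉ S → (F'.Adj u v ↔ F.Adj u v)) ∧
          ∃ (k : ℕ) (B : Fin k → Finset V),
            IsCyclicBraid F' B ∧ clusterSizes B = extremalClusterSizes (Fintype.card V) := by
  classical
  obtain ⟨C, hchain⟩ := exists_isClusterChain_of_le_numInducedCycles (div_pos hα three_pos)
  refine ⟨C, 9, fun {V} _ F hn hF ↦ ?_⟩
  have hcycles : α / 3 * cbrtThree ^ Fintype.card V ≤ numInducedCycles F := calc
    _ ≤ α / 3 * (3 * maxInducedCycles (Fintype.card V)) := by
      gcongr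
      exact cbrtThree_pow_le_mul_maxInducedCycles hn
    _ = α * maxInducedCycles (Fintype.card V) := by ring
    _ ≤ numInducedCycles F := hF
  obtain ⟨S, W, Q, L, hS, hWS, hW, hL⟩ := hchain hcycles
  obtain ⟨F', hF', hbraid⟩ := hL.exists_isCyclicBraid hn hWS hW
  exact ⟨S, F', hS, hF', hbraid⟩

theorem theorem1p4 (α : ℝ) (hα₀ : 0 < α) (hα₁ : α < 1) :
    ∃ C n₀ : ℕ, ∀ n : ℕ, n₀ ≤ n → ∀ F : SimpleGraph (Fin n),
      α * (maxInducedCycles n : ℝ) ≤ (numInducedCycles F : ℝ) →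
        ∃ (S : Finset (Fin n)) (F' : SimpleGraph (Fin n)),
          S.card ≤ C ∧
          (∀ u v : Fin n, u ∉ S → v ∉ S → (F'.Adj u v ↔ F.Adj u v)) ∧
          ∃ (k : ℕ) (B : Fin k → Finset (Fin n)),
            IsCyclicBraid F' B ∧ clusterSizes B = extremalClusterSizes n := by
  obtain ⟨C, n₀, hC⟩ := theorem1p4_general hα₀
  exact ⟨C, n₀, fun n hn F hF ↦ by simpa using hC F (by simpa using hn) (by simpa using hF)⟩
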